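/- Let $S$ be a smooth surface in the oriented affine space $\mathbb{R}^3$. At a point of $S$, an asymptotic line is a tangent line having more than $2$-point contact with $S$; the point is elliptic, parabolic or hyperbolic if there are no, one or two asymptotic lines. At a hyperbolic point one asymptotic line is right and the other is left: the tangent plane of $S$ twists along it like a right (resp. left) screw; equivalently, wherever the first three derivatives of the corresponding asymptotic curve are independent, they form a positive (resp. negative) frame. The flecnodal curve $F$ consists of the points of the closure of the hyperbolic domain at which an asymptotic line has more than $3$-point contact with $S$; its right (left) branch $F_r$ ($F_l$) consists of the hyperbolic points of $F$ at which such a line is a right (left) asymptotic line. Let $g$ be a simple godron of $S$, that is, a parabolic point at which the asymptotic direction is tangent to the (smooth) parabolic curve and at which the contact of $S$ with its tangent plane is of type $A_3$ (equivalently, a godron whose cr-invariant $\rho$ is not $1$). The godron is positive (resp. negative) if at the neighbouring parabolic points the half-asymptotic lines directed to the hyperbolic domain point towards (resp. away from) $g$. Take affine coordinates $x,y,z$ with origin $g$ such that the $(x,y)$-plane is tangent to $S$ at $g$; the $x$-axis is tangent to the parabolic curve at $g$; the positive $z$-axis is directed to the positive half-space at $g$ (the limit of the half-spaces, bounded by the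 tangent planes at the neighbouring elliptic points, that contain $S$ locally); the positive $y$-axis is directed towards the neighbouring hyperbolic domain; and the frame $(e_x,e_y,e_z)$ is positive. Then, near $g$, the flecnodal curve is smoothly parametrised by its projection to the $x$-axis. Under this parametrisation, $F_l$ and $F_r$ correspond locally to the negative and the positive semi-axis of the $x$-axis, respectively, if and only if $g$ is positive; and $F_l$ and $F_r$ correspond locally to the positive and the negative semi-axis, respectively, if and only if $g$ is negative. -/

import Mathlib

open Set Filter
open scoped Topology ContDiff

/-- The ambient space. Its inner product is used only to say that a vector makes an acute
(obtuse) angle with a nearly parallel one; everything else is affine. -/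
abbrev R3 : Type := EuclideanSpace ℝ (Fin 3)

/-- `F` is a regular smooth local equation of `S` near `q`. -/
def IsLocalEquation (S : Set R3) (q : R3) (F : R3 → ℝ) : Prop :=
  ∃ U : Set R3, IsOpen U ∧ q ∈ U ∧ ContDiffOn ℝ ∞ F U ∧ (∀ p ∈ U, fderiv ℝ F p ≠ 0) ∧
    S ∩ U = {p ∈ U | F p = 0}

/-- Smooth (embedded) surfaces of 3-space. -/
def IsSmoothSurface (S : Set R3) : Prop :=
  ∀ q ∈ S, ∃ F : R3 → ℝ, IsLocalEquation S q F

/-- The line through `q` with direction `v` has at least `k`-point contact with `S` at `q`: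
the restriction to it of a local equation of `S` has a zero of multiplicity at least `k`.
(By convention this also holds for `v = 0`, if `q` is on `S`.) -/
def LineContact (S : Set R3) (q v : R3) (k : ℕ) : Prop :=
  ∃ F : R3 → ℝ, IsLocalEquation S q F ∧
    ∀ j < k, iteratedDeriv j (fun t : ℝ => F (q + t • v)) 0 = 0

/-- `v` is tangent to `S` at `q`, that is, `v` belongs to the (linear) tangent plane. -/
def IsTangentVector (S : Set R3) (q v : R3) : Prop := LineContact S q v 2

/-- `v` is zero or spans an asymptotic line: more than 2-point contact. -/
def IsAsymptoticVector (S : Set R3) (q v : R3) : Prop := LineContact S q v 3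

/-- Elliptic points: no asymptotic line. -/
def ellipticDomain (S : Set R3) : Set R3 :=
  {q ∈ S | ∀ v, IsAsymptoticVector S q v → v = 0}

/-- Hyperbolic points: exactly two asymptotic lines. -/
def hyperbolicDomain (S : Set R3) : Set R3 :=
  {q ∈ S | ∃ v₁ v₂ : R3, LinearIndependent ℝ ![v₁, v₂] ∧
    ∀ v, IsAsymptoticVector S q v ↔
      v ∈ Submodule.span ℝ {v₁} ∨ v ∈ Submodule.span ℝ {v₂}}

/-- Parabolic points: a unique asymptotic line. -/
def parabolicCurve (S : Set R3) : Set R3 :=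
  {q ∈ S | ∃ v₁ : R3, v₁ ≠ 0 ∧ ∀ v, IsAsymptoticVector S q v ↔ v ∈ Submodule.span ℝ {v₁}}

/-- The set `C` is, near its point `q`, a regular smooth arc, and `v` is a nonzero tangent vector
of this arc at `q`. -/
def IsArcTangent (C : Set R3) (q v : R3) : Prop :=
  ∃ (γ : ℝ → R3) (ε : ℝ), 0 < ε ∧ ContDiffOn ℝ ∞ γ (Ioo (-ε) ε) ∧ γ 0 = q ∧
    deriv γ 0 = v ∧ v ≠ 0 ∧ Filter.map γ (𝓝 0) = 𝓝[C] q

/-- The half-line of origin `q` and direction `v`, tangent to `S`, is directed to the part `H` of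
`S`: some smooth curve of `S` leaves `q` with velocity `v ≠ 0` and enters `H`. -/
def IsDirectedTo (S H : Set R3) (q v : R3) : Prop :=
  v ≠ 0 ∧ ∃ (γ : ℝ → R3) (ε : ℝ), 0 < ε ∧ ContDiffOn ℝ ∞ γ (Ioo (-ε) ε) ∧ γ 0 = q ∧
    deriv γ 0 = v ∧ (∀ t ∈ Ioo (-ε) ε, γ t ∈ S) ∧ ∀ t ∈ Ioo 0 ε, γ t ∈ H

/-- A godron: a parabolic point at which the asymptotic direction is tangent to the parabolic
curve (which is a smooth curve there). -/
def IsGodron (S : Set R3) (g : R3) : Prop :=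
  g ∈ parabolicCurve S ∧ ∃ v, IsAsymptoticVector S g v ∧ IsArcTangent (parabolicCurve S) g v

/-- The contact of `S` with its tangent plane at `g` is of type `A₃`: in suitable smooth local
coordinates of `S`, an equation of the plane restricted to `S` is `u ^ 2 + v ^ 4` or
`u ^ 2 - v ^ 4`. -/
def HasA3Contact (S : Set R3) (g : R3) : Prop :=
  ∃ (φ : ℝ × ℝ → R3) (W : Set (ℝ × ℝ)) (l : R3 →L[ℝ] ℝ) (δ : ℝ),
    IsOpen W ∧ (0 : ℝ × ℝ) ∈ W ∧ ContDiffOn ℝ ∞ φ W ∧ φ 0 = g ∧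
    Function.Injective (fderiv ℝ φ 0) ∧ (δ = 1 ∨ δ = -1) ∧
    ∀ w ∈ W, φ w ∈ S ∧ l (φ w - g) = w.1 ^ 2 + δ * w.2 ^ 4

/-- Simple godrons. -/
def IsSimpleGodron (S : Set R3) (g : R3) : Prop := IsGodron S g ∧ HasA3Contact S g

/-- Index `+1`: at the neighbouring parabolic points the half-asymptotic lines directed to the
hyperbolic domain point towards `g`. These half-lines and the secants from `g` become parallel to
one line as `q` tends to `g`, so the sign does not depend on the inner product. -/
def IsPositiveGodron (S : Set R3) (g : R3) : Prop :=
  ∀ᶠ q in 𝓝[parabolicCurve S \ {g}] g, ∀ v, IsAsymptoticVector S q v →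
    IsDirectedTo S (hyperbolicDomain S) q v → 0 < inner ℝ v (g - q)

/-- Index `-1`: these half-asymptotic lines point away from `g`. -/
def IsNegativeGodron (S : Set R3) (g : R3) : Prop :=
  ∀ᶠ q in 𝓝[parabolicCurve S \ {g}] g, ∀ v, IsAsymptoticVector S q v →
    IsDirectedTo S (hyperbolicDomain S) q v → inner ℝ v (g - q) < 0

/-- `(u, v, w)` is a positive frame for the orientation `o`. -/
def IsPositiveFrame (o : Orientation ℝ R3 (Fin 3)) (u v w : R3) : Prop :=
  ∃ b : Module.Basis (Fin 3) ℝ R3, ⇑b = ![u, v, w] ∧ b.orientation = o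

/-- The asymptotic line of `S` at the hyperbolic point `q` in the direction `v` is right: the
tangent plane of `S` twists like a right screw along `v`, that is, `(v, w, w')` is a positive
frame for a field `w` of vectors tangent to `S` along a curve of `S` of velocity `v` at `q`.
The sign depends neither on the curve nor on `w` (provided that `v` and `w` are independent).
The second derivative of an asymptotic curve is tangent to `S`; so, where it is independent of the
first one, it can be taken as `w`, and the condition is that the first three derivatives of the
asymptotic curve form a positive frame. The present form makes sense also at the inflections of
the asymptotic curve, which are the flecnodal points. -/
def IsRightAsymptotic (o : Orientation ℝ R3 (Fin 3)) (S : Set R3) (q v : R3) : Prop :=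
  q ∈ hyperbolicDomain S ∧ IsAsymptoticVector S q v ∧
    ∃ (γ w : ℝ → R3) (ε : ℝ), 0 < ε ∧ ContDiffOn ℝ ∞ γ (Ioo (-ε) ε) ∧
      ContDiffOn ℝ ∞ w (Ioo (-ε) ε) ∧ γ 0 = q ∧ deriv γ 0 = v ∧
      (∀ t ∈ Ioo (-ε) ε, γ t ∈ S ∧ IsTangentVector S (γ t) (w t)) ∧
      IsPositiveFrame o v (w 0) (deriv w 0)

/-- Left asymptotic lines: the same with negative frames. -/
def IsLeftAsymptotic (o : Orientation ℝ R3 (Fin 3)) (S : Set R3) (q v : R3) : Prop :=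
  IsRightAsymptotic (-o) S q v

/-- The flecnodal curve: the points of the closure of the hyperbolic domain at which an asymptotic
line exceeds 3-point contact. -/
def flecnodalCurve (S : Set R3) : Set R3 :=
  {q ∈ S | q ∈ closure (hyperbolicDomain S) ∧ ∃ v, v ≠ 0 ∧ LineContact S q v 4}

/-- The right flecnodal curve. -/
def rightFlecnodalCurve (o : Orientation ℝ R3 (Fin 3)) (S : Set R3) : Set R3 :=
  {q ∈ flecnodalCurve S | ∃ v, v ≠ 0 ∧ LineContact S q v 4 ∧ IsRightAsymptotic o S q v}

/-- The left flecnodal curve. -/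
def leftFlecnodalCurve (o : Orientation ℝ R3 (Fin 3)) (S : Set R3) : Set R3 :=
  {q ∈ flecnodalCurve S | ∃ v, v ≠ 0 ∧ LineContact S q v 4 ∧ IsLeftAsymptotic o S q v}

/-- At the elliptic point `q`, the vector `e` is directed to the half-space, bounded by the tangent
plane, on whose side `S` lies locally. -/
def IsPositiveSide (S : Set R3) (q e : R3) : Prop :=
  ¬ IsTangentVector S q e ∧
    ∀ᶠ p in 𝓝[S] q, ∃ (w : R3) (s : ℝ), IsTangentVector S q w ∧ 0 ≤ s ∧ p - q = w + s • e

/-- At the point `g` of the boundary of the elliptic domain, `e` is directed to the positive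
half-space, defined by continuity from the neighbouring elliptic points. -/
def IsDirectedToPositiveHalfSpace (S : Set R3) (g e : R3) : Prop :=
  ¬ IsTangentVector S g e ∧ g ∈ closure (ellipticDomain S) ∧
    ∀ᶠ q in 𝓝[ellipticDomain S] g, IsPositiveSide S q e

/-- The affine coordinate system `x, y, z` with origin `g` and basis `b = (e_x, e_y, e_z)` is
adapted to `S` at `g`. -/
structure IsAdaptedFrame (o : Orientation ℝ R3 (Fin 3)) (S : Set R3) (g : R3)
    (b : Module.Basis (Fin 3) ℝ R3) : Prop where
  x_tangent : IsTangentVector S g (b 0)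
  y_tangent : IsTangentVector S g (b 1)
  x_parabolic : IsArcTangent (parabolicCurve S) g (b 0)
  y_hyperbolic : IsDirectedTo S (hyperbolicDomain S) g (b 1)
  z_positive : IsDirectedToPositiveHalfSpace S g (b 2)
  positive : b.orientation = o

/-! In adapted coordinates `S` is, near `g`, a graph z = f(x, y), and the hypotheses become
conditions on the 4-jet of f at the origin: f, f_x, f_y, f_xx, f_xy, f_xxx vanish, f_yy > 0, f_xxy <
0, and D = f_yy f_xxxx - 3 f_xxy² is not 0 (`exists_isGodronJet`). The sign of D, which is
`godronSign f`, decides both the index of the godron and the sides on which the flecnodal branches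
lie.

Index (`IsGodronJet.parabolic_index`). Near `g` the hyperbolic domain is H < 0, where H is the
Hessian determinant. At a parabolic point the asymptotic direction is (1, r) with r = -f_xy / f_yy.
The derivative of H in this direction is 0 at `g`, and its own derivative along the parabolic arc,
parametrised with velocity e_x at `g`, is D. Hence the half-line entering H < 0 points towards `g`
exactly when D > 0.

Flecnodal curve (`IsGodronJet.exists_branch`, `IsGodronJet.flecnodal`). The direction (1, r) over
(x, y) has 4-point contact when the second and third differentials of f vanish on it. At the origin
the Jacobian of these two equations in (y, r) is triangular with diagonal f_xxy, 3 f_xxy, so y and r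
are smooth functions of x. The tangent plane twists along the direction with the sign of Q = f_xy +
f_yy r (`IsGraphOn.rightAsymptotic_iff`), and Q² = -H on the curve, so Q ≠ 0 also gives
hyperbolicity. Differentiating the equations at 0 gives y' = 0 and r' = -f_xxxx / (3 f_xxy), whence
Q' = D / (-3 f_xxy), of the sign of D. The line is therefore right where D x > 0 and left where D x
< 0.

That D ≠ 0 is the content of the A₃ hypothesis (`three_mul_sq_ne_of_equiv_A3`): if D = 0, then f and
its gradient are too flat along the parabola y = α x² with α = -f_xxy / (2 f_yy). -/

/-! ### One-variable Taylor estimates -/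

/-- Taylor's formula at the origin, with Peano remainder. -/
theorem taylor_zero_isLittleO {φ : ℝ → ℝ} {n : ℕ} (h : ContDiffAt ℝ n φ 0) :
    (fun t => φ t - ∑ j ∈ Finset.range (n + 1), ((j.factorial : ℝ)⁻¹ * t ^ j) *
      iteratedDeriv j φ 0) =o[𝓝 0] fun t : ℝ => t ^ n := by
  obtain ⟨u, hu, hφ⟩ := h.contDiffOn le_rfl (by simp)
  obtain ⟨r, hr, hru⟩ := Metric.mem_nhds_iff.1 (by simpa using hu)
  have h0 : (0 : ℝ) ∈ Metric.ball (0 : ℝ) r := Metric.mem_ball_self hr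
  have := taylor_isLittleO (convex_ball (0 : ℝ) r) h0 (hφ.mono hru)
  rw [Metric.isOpen_ball.nhdsWithin_eq h0] at this
  refine this.congr (fun t => ?_) (fun t => by simp)
  rw [taylor_within_apply]
  congr 1
  refine Finset.sum_congr rfl fun j _ => ?_
  rw [iteratedDerivWithin_of_isOpen Metric.isOpen_ball h0]
  simp

/-- Turns a multiplicity into a growth estimate, so that two equations of the surface can be
compared without differentiating composites. -/
theorem iteratedDeriv_eq_zero_iff_isBigO_pow {φ : ℝ → ℝ} {k : ℕ} (h : ContDiffAt ℝ k φ 0) :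
    (∀ j < k, iteratedDeriv j φ 0 = 0) ↔ φ =O[𝓝 0] fun t : ℝ => t ^ k := by
  constructor
  · intro hj
    have h1 := taylor_zero_isLittleO h
    have h2 : (fun t : ℝ => ∑ j ∈ Finset.range (k + 1), ((j.factorial : ℝ)⁻¹ * t ^ j) *
        iteratedDeriv j φ 0) =O[𝓝 0] fun t : ℝ => t ^ k := by
      have : (fun t : ℝ => ∑ j ∈ Finset.range (k + 1), ((j.factorial : ℝ)⁻¹ * t ^ j) *
          iteratedDeriv j φ 0) = fun t => ((k.factorial : ℝ)⁻¹ * iteratedDeriv k φ 0) * t ^ k := by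
        ext t
        rw [Finset.sum_range_succ, Finset.sum_eq_zero]
        · ring
        · intro j hjk
          rw [hj j (Finset.mem_range.1 hjk), mul_zero]
      rw [this]
      exact Asymptotics.isBigO_const_mul_self _ _ _
    simpa using h1.isBigO.add h2
  · intro hO j
    induction j using Nat.strong_induction_on with
    | _ j ih =>
      intro hjk
      have h1 := taylor_zero_isLittleO (h.of_le (by exact_mod_cast hjk.le : ((j : ℕ∞) : WithTop ℕ∞) ≤ k))
      have h2 : φ =o[𝓝 0] fun t : ℝ => t ^ j :=
        hO.trans_isLittleO (Asymptotics.isLittleO_pow_pow hjk)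
      have h3 := h2.sub h1
      have h4 : (fun t : ℝ => ((j.factorial : ℝ)⁻¹ * iteratedDeriv j φ 0) * t ^ j) =o[𝓝 0]
          fun t : ℝ => t ^ j := by
        refine h3.congr (fun t => ?_) (fun t => rfl)
        rw [Finset.sum_range_succ, Finset.sum_eq_zero]
        · ring
        · intro i hi
          rw [ih i (Finset.mem_range.1 hi) ((Finset.mem_range.1 hi).trans hjk), mul_zero]
      by_contra hne
      have hc : ((j.factorial : ℝ)⁻¹ * iteratedDeriv j φ 0) ≠ 0 :=
        mul_ne_zero (inv_ne_zero (by positivity)) hne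
      have h5 := (Asymptotics.isLittleO_const_mul_left_iff hc).1 h4
      have h6 := Asymptotics.isLittleO_irrefl' (f' := fun t : ℝ => t ^ j) (l := 𝓝[≠] (0 : ℝ)) (by
        refine Eventually.frequently ?_
        filter_upwards [self_mem_nhdsWithin] with t ht
        exact norm_ne_zero_iff.2 (pow_ne_zero _ ht))
      exact h6 (h5.mono nhdsWithin_le_nhds)

/-- A function vanishing with its first derivatives at the origin is small. -/
theorem isLittleO_pow_of_iteratedDeriv_eq_zero {φ : ℝ → ℝ} {k : ℕ} (h : ContDiffAt ℝ k φ 0)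
    (hj : ∀ j ≤ k, iteratedDeriv j φ 0 = 0) : φ =o[𝓝 0] fun t : ℝ => t ^ k := by
  refine (taylor_zero_isLittleO h).congr (fun t => ?_) (fun t => rfl)
  rw [Finset.sum_eq_zero, sub_zero]
  intro j hjk
  rw [hj j (Nat.lt_succ_iff.1 (Finset.mem_range.1 hjk)), mul_zero]

/-- Second order necessary condition for a minimum. -/
theorem IsLocalMin.deriv_deriv_nonneg {h : ℝ → ℝ} {a : ℝ} (hm : IsLocalMin h a)
    (hc : ContinuousAt h a) : 0 ≤ deriv (deriv h) a := by
  by_contra! hneg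
  have hM := isLocalMax_of_deriv_deriv_neg hneg hm.deriv_eq_zero hc
  -- A point that is both a local minimum and a local maximum makes `h` locally constant, so its
  -- second derivative would be 0.
  have he : h =ᶠ[𝓝 a] fun _ => h a := by
    filter_upwards [hm, hM] with t h1 h2
    exact le_antisymm h2 h1
  have : deriv (deriv h) a = 0 := by
    rw [he.deriv.deriv_eq]
    simp
  linarith

/-! ### Partial derivatives in the plane -/

/-- First partial derivative. -/
noncomputable def px (f : ℝ × ℝ → ℝ) (p : ℝ × ℝ) : ℝ := fderiv ℝ f p (1, 0)

/-- Second partial derivative. -/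
noncomputable def py (f : ℝ × ℝ → ℝ) (p : ℝ × ℝ) : ℝ := fderiv ℝ f p (0, 1)

section partials

variable {f : ℝ × ℝ → ℝ}

@[fun_prop]
theorem ContDiff.px (hf : ContDiff ℝ ∞ f) : ContDiff ℝ ∞ (px f) := by
  unfold _root_.px
  exact (hf.fderiv_right (m := ∞) (by simp)).clm_apply contDiff_const

@[fun_prop]
theorem ContDiff.py (hf : ContDiff ℝ ∞ f) : ContDiff ℝ ∞ (py f) := by
  unfold _root_.py
  exact (hf.fderiv_right (m := ∞) (by simp)).clm_apply contDiff_const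

theorem fderiv_eq_partials (f : ℝ × ℝ → ℝ) (p v : ℝ × ℝ) :
    fderiv ℝ f p v = px f p * v.1 + py f p * v.2 := by
  have : v = v.1 • ((1, 0) : ℝ × ℝ) + v.2 • ((0, 1) : ℝ × ℝ) := by ext <;> simp
  conv_lhs => rw [this]
  rw [map_add, map_smul, map_smul, px, py]
  simp [mul_comm]

theorem py_px (hf : ContDiff ℝ ∞ f) : py (px f) = px (py f) := by
  ext p
  have hd : DifferentiableAt ℝ (fderiv ℝ f) p :=
    ((hf.fderiv_right (m := ∞) (by simp)).differentiable (by simp)) p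
  have h1 : ∀ v w : ℝ × ℝ, fderiv ℝ (fun q => fderiv ℝ f q v) p w = fderiv ℝ (fderiv ℝ f) p w v := by
    intro v w
    rw [fderiv_clm_apply hd (differentiableAt_const v)]
    simp
  have hs : IsSymmSndFDerivAt ℝ f p :=
    hf.contDiffAt.isSymmSndFDerivAt (by simpa using WithTop.coe_le_coe.2 (le_top : (2 : ℕ∞) ≤ ⊤))
  change fderiv ℝ (fun q => fderiv ℝ f q (1, 0)) p (0, 1) =
    fderiv ℝ (fun q => fderiv ℝ f q (0, 1)) p (1, 0)
  rw [h1, h1, hs.eq]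

theorem HasDerivAt.comp_partials (hf : ContDiff ℝ ∞ f) {X Y : ℝ → ℝ} {x' y' t : ℝ}
    (hX : HasDerivAt X x' t) (hY : HasDerivAt Y y' t) :
    HasDerivAt (fun s => f (X s, Y s)) (_root_.px f (X t, Y t) * x' + _root_.py f (X t, Y t) * y') t := by
  have h1 : HasFDerivAt f (fderiv ℝ f (X t, Y t)) (X t, Y t) :=
    (hf.differentiable (by simp) _).hasFDerivAt
  have h2 := h1.comp_hasDerivAt t (hX.prodMk hY)
  rw [fderiv_eq_partials] at h2
  exact h2

end partials

/-! ### Implicit functions and smooth extension of germs -/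

/-- The implicit function theorem, with an implicit function that is smooth on a neighbourhood. -/
theorem exists_contDiffOn_implicitFunction {E₁ E₂ F : Type*}
    [NormedAddCommGroup E₁] [NormedSpace ℝ E₁] [CompleteSpace E₁]
    [NormedAddCommGroup E₂] [NormedSpace ℝ E₂] [CompleteSpace E₂]
    [NormedAddCommGroup F] [NormedSpace ℝ F] [CompleteSpace F]
    {G : E₁ × E₂ → F} {u : E₁ × E₂} {U : Set (E₁ × E₂)} (hU : IsOpen U) (hu : u ∈ U)
    (hG : ContDiffOn ℝ ∞ G U)
    (hinv : (fderiv ℝ G u ∘L .inr ℝ E₁ E₂).IsInvertible) :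
    ∃ (ψ : E₁ → E₂) (W : Set E₁), IsOpen W ∧ u.1 ∈ W ∧ ContDiffOn ℝ ∞ ψ W ∧ ψ u.1 = u.2 ∧
      ∀ᶠ v in 𝓝 u, G v = G u ↔ ψ v.1 = v.2 := by
  have hGa : ∀ v ∈ U, ContDiffAt ℝ ∞ G v := fun v hv => hG.contDiffAt (hU.mem_nhds hv)
  have cdf := hGa u hu
  have pn : (∞ : WithTop ℕ∞) ≠ 0 := by simp
  set ψ := cdf.implicitFunction pn hinv with hψ
  have hψu : ψ u.1 = u.2 := cdf.implicitFunction_apply_self pn hinv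
  have hψs : ContDiffAt ℝ ∞ ψ u.1 := cdf.contDiffAt_implicitFunction pn hinv
  have h1 : ∀ᶠ x in 𝓝 u.1, ContinuousAt ψ x :=
    ((hψs.of_le (m := 1) (by simp)).eventually (by simp)).mono fun x hx => hx.continuousAt
  have hgraph : ContinuousAt (fun x => (x, ψ x)) u.1 := continuousAt_id.prodMk hψs.continuousAt
  have hgraph' : Tendsto (fun x => (x, ψ x)) (𝓝 u.1) (𝓝 u) := by
    have := hgraph.tendsto
    rwa [hψu] at this
  have h2 : ∀ᶠ x in 𝓝 u.1, (x, ψ x) ∈ U := hgraph'.eventually (hU.mem_nhds hu)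
  have hcont : ContinuousAt (fun v => fderiv ℝ G v ∘L .inr ℝ E₁ E₂) u := by
    have : ContinuousAt (fderiv ℝ G) u :=
      (cdf.fderiv_right (m := 0) (by simp)).continuousAt
    exact this.clm_comp continuousAt_const
  have hopen : ∀ᶠ v in 𝓝 u, (fderiv ℝ G v ∘L .inr ℝ E₁ E₂).IsInvertible := by
    have : range ((↑) : (E₂ ≃L[ℝ] F) → E₂ →L[ℝ] F) ∈ 𝓝 (fderiv ℝ G u ∘L .inr ℝ E₁ E₂) :=
      ContinuousLinearEquiv.isOpen.mem_nhds hinv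
    exact hcont.eventually this
  have h3 : ∀ᶠ x in 𝓝 u.1, (fderiv ℝ G (x, ψ x) ∘L .inr ℝ E₁ E₂).IsInvertible :=
    hgraph'.eventually hopen
  have h4 : ∀ᶠ x in 𝓝 u.1, ∀ᶠ x' in 𝓝 x, G (x', ψ x') = G u :=
    (cdf.eventually_apply_implicitFunction pn hinv).eventually_nhds
  -- Invertibility of the partial differential is an open condition, so the theorem applies again at
  -- each nearby point `(x, ψ x)` of the graph. By uniqueness the implicit function obtained there
  -- agrees with `ψ` near `x`, which makes `ψ` smooth at `x`.
  have key : ∀ᶠ x in 𝓝 u.1, ContDiffAt ℝ ∞ ψ x := by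
    filter_upwards [h1, h2, h3, h4] with x hx1 hx2 hx3 hx4
    have cdx := hGa _ hx2
    have e := cdx.eventually_apply_eq_iff_implicitFunction pn hx3
    have ht : Tendsto (fun x => (x, ψ x)) (𝓝 x) (𝓝 (x, ψ x)) :=
      (continuousAt_id.prodMk hx1).tendsto
    refine (cdx.contDiffAt_implicitFunction pn hx3).congr_of_eventuallyEq ?_
    filter_upwards [ht.eventually e, hx4] with x' h5 h6
    rw [h6, hx4.self_of_nhds] at h5
    exact (h5.1 rfl).symm
  obtain ⟨W, hW, hWo, huW⟩ := eventually_nhds_iff.1 key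
  exact ⟨ψ, W, hWo, huW, fun x hx => (hW x hx).contDiffWithinAt, hψu,
    cdf.eventually_apply_eq_iff_implicitFunction pn hinv⟩

/-- A function that is smooth near a point agrees near it with a globally smooth function. -/
theorem exists_contDiff_eventuallyEq {E F : Type*} [NormedAddCommGroup E] [NormedSpace ℝ E]
    [FiniteDimensional ℝ E] [NormedAddCommGroup F] [NormedSpace ℝ F] {ψ : E → F} {W : Set E}
    {a : E} (hW : IsOpen W) (ha : a ∈ W) (hψ : ContDiffOn ℝ ∞ ψ W) :
    ∃ f : E → F, ContDiff ℝ ∞ f ∧ f =ᶠ[𝓝 a] ψ := by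
  obtain ⟨r, hr, hrW⟩ := Metric.isOpen_iff.1 hW a ha
  let β : ContDiffBump a := ⟨r / 4, r / 2, by positivity, by linarith⟩
  refine ⟨fun p => β p • ψ p, ?_, ?_⟩
  · refine contDiff_iff_contDiffAt.2 fun p => ?_
    by_cases hp : p ∈ W
    · exact β.contDiffAt.smul (hψ.contDiffAt (hW.mem_nhds hp))
    · have : p ∉ tsupport β := by
        rw [β.tsupport_eq]
        intro h
        exact hp (hrW ((Metric.closedBall_subset_ball (by change r / 2 < r; linarith)) h))
      have he : (fun p => β p • ψ p) =ᶠ[𝓝 p] fun _ => 0 := by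
        filter_upwards [notMem_tsupport_iff_eventuallyEq.1 this] with q hq
        simp [hq]
      exact contDiffAt_const.congr_of_eventuallyEq he
  · filter_upwards [β.eventuallyEq_one] with q hq
    simp [hq]

/-! ### Affine coordinates and the surface as a graph -/

/-- The coordinates with respect to a basis, as continuous linear forms. -/
noncomputable def crd (b : Module.Basis (Fin 3) ℝ R3) (i : Fin 3) : R3 →L[ℝ] ℝ :=
  LinearMap.toContinuousLinearMap (b.coord i)

/-- The affine parametrisation of the graph of `f`. -/
noncomputable def graphPt (b : Module.Basis (Fin 3) ℝ R3) (g : R3) (f : ℝ × ℝ → ℝ)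
    (p : ℝ × ℝ) : R3 := g + (p.1 • b 0 + p.2 • b 1 + f p • b 2)

section coordinates

variable {b : Module.Basis (Fin 3) ℝ R3} {g : R3} {f : ℝ × ℝ → ℝ}

theorem coord_eq_crd (i : Fin 3) (v : R3) : b.coord i v = crd b i v := rfl

@[simp] theorem crd_basis (i j : Fin 3) : crd b i (b j) = if j = i then 1 else 0 := by
  simp [crd, Finsupp.single_apply]

theorem sum_crd (v : R3) : v = crd b 0 v • b 0 + crd b 1 v • b 1 + crd b 2 v • b 2 := by
  conv_lhs => rw [← b.sum_repr v, Fin.sum_univ_three]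
  rfl

theorem ext_crd {v w : R3} (h0 : crd b 0 v = crd b 0 w) (h1 : crd b 1 v = crd b 1 w)
    (h2 : crd b 2 v = crd b 2 w) : v = w := by
  rw [sum_crd (b := b) v, sum_crd (b := b) w, h0, h1, h2]

@[simp] theorem crd_zero_graphPt (p : ℝ × ℝ) : crd b 0 (graphPt b g f p - g) = p.1 := by
  simp [graphPt]

@[simp] theorem crd_one_graphPt (p : ℝ × ℝ) : crd b 1 (graphPt b g f p - g) = p.2 := by
  simp [graphPt]

@[simp] theorem crd_two_graphPt (p : ℝ × ℝ) : crd b 2 (graphPt b g f p - g) = f p := by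
  simp [graphPt]

theorem ContDiff.graphPt (hf : ContDiff ℝ ∞ f) : ContDiff ℝ ∞ (graphPt b g f) := by
  unfold _root_.graphPt
  fun_prop

theorem eq_graphPt {p : R3} (h : crd b 2 (p - g) = f (crd b 0 (p - g), crd b 1 (p - g))) :
    p = graphPt b g f (crd b 0 (p - g), crd b 1 (p - g)) := by
  rw [← sub_left_inj (a := g)]
  exact ext_crd (b := b) (by simp) (by simp) (by simp [h])

end coordinates

/-- On the open neighbourhood `V` of `g`, the set `S` is the graph of the smooth function `f`, in
the affine coordinates with origin `g` and basis `b`. -/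
structure IsGraphOn (S : Set R3) (g : R3) (b : Module.Basis (Fin 3) ℝ R3) (f : ℝ × ℝ → ℝ)
    (V : Set R3) : Prop where
  smooth : ContDiff ℝ ∞ f
  isOpen : IsOpen V
  mem : g ∈ V
  mem_iff : ∀ p ∈ V, p ∈ S ↔ crd b 2 (p - g) = f (crd b 0 (p - g), crd b 1 (p - g))

/-- The implicit function theorem in a direction `b 2` transverse to the surface. Replacing the
implicit function by a globally smooth one with the same germ spares all later statements a domain
of smoothness. -/
theorem IsLocalEquation.exists_isGraphOn {S : Set R3} {g : R3} {F : R3 → ℝ}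
    (hF : IsLocalEquation S g F) (hg : g ∈ S) (b : Module.Basis (Fin 3) ℝ R3)
    (h2 : fderiv ℝ F g (b 2) ≠ 0) : ∃ f V, IsGraphOn S g b f V ∧ f 0 = 0 := by
  obtain ⟨U, hU, hgU, hFs, -, hSU⟩ := hF
  let E : (ℝ × ℝ) × ℝ → R3 := fun v => g + (v.1.1 • b 0 + v.1.2 • b 1 + v.2 • b 2)
  have hE : ContDiff ℝ ∞ E := by fun_prop
  have hE0 : E 0 = g := by simp [E]
  have hFg : F g = 0 := by
    have : g ∈ S ∩ U := ⟨hg, hgU⟩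
    rw [hSU] at this
    exact this.2
  have hG : ContDiffOn ℝ ∞ (F ∘ E) (E ⁻¹' U) := hFs.comp hE.contDiffOn (fun _ h => h)
  have hder : fderiv ℝ (F ∘ E) 0 ∘L .inr ℝ (ℝ × ℝ) ℝ =
      ContinuousLinearMap.toSpanSingleton ℝ (fderiv ℝ F g (b 2)) := by
    have hFd : HasFDerivAt F (fderiv ℝ F g) (E 0) := by
      rw [hE0]
      exact ((hFs.contDiffAt (hU.mem_nhds hgU)).differentiableAt (by simp)).hasFDerivAt
    have hEd : HasFDerivAt E (fderiv ℝ E 0) 0 := (hE.differentiable (by simp) 0).hasFDerivAt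
    have hcomp := hFd.comp (0 : (ℝ × ℝ) × ℝ) hEd
    rw [hcomp.fderiv]
    ext
    have h3 : HasDerivAt (fun t : ℝ => E ((0, 0), t)) (b 2) 0 := by
      have : HasDerivAt (fun t : ℝ => g + ((0 : ℝ) • b 0 + (0 : ℝ) • b 1 + t • b 2))
          ((1 : ℝ) • b 2) 0 :=
        (((hasDerivAt_id (0 : ℝ)).smul_const (b 2)).const_add _).const_add _
      rw [one_smul] at this
      exact this
    have h4 : HasDerivAt (fun t : ℝ => E ((0, 0), t)) (fderiv ℝ E 0 ((0, 0), 1)) 0 := by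
      have hl : HasDerivAt (fun t : ℝ => (((0, 0), t) : (ℝ × ℝ) × ℝ)) ((0, 0), 1) 0 :=
        (hasDerivAt_const (0 : ℝ) ((0, 0) : ℝ × ℝ)).prodMk (hasDerivAt_id (0 : ℝ))
      exact HasFDerivAt.comp_hasDerivAt (f := fun t : ℝ => (((0, 0), t) : (ℝ × ℝ) × ℝ)) (0 : ℝ)
        hEd hl
    have h5 := h4.unique h3
    simp only [ContinuousLinearMap.comp_apply, ContinuousLinearMap.inr_apply,
      ContinuousLinearMap.toSpanSingleton_apply, one_smul]
    rw [← h5]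
    rfl
  have hinv : (fderiv ℝ (F ∘ E) 0 ∘L .inr ℝ (ℝ × ℝ) ℝ).IsInvertible := by
    rw [hder]
    refine ⟨ContinuousLinearEquiv.unitsEquivAut ℝ (Units.mk0 _ h2), ?_⟩
    ext
    simp
  obtain ⟨ψ, W, hW, h0W, hψ, hψ0, hψiff⟩ := exists_contDiffOn_implicitFunction
    (hU.preimage hE.continuous) (by simpa [hE0] using hgU) hG hinv
  obtain ⟨f, hf, hfψ⟩ := exists_contDiff_eventuallyEq hW h0W hψ
  let C : R3 → (ℝ × ℝ) × ℝ := fun p => ((crd b 0 (p - g), crd b 1 (p - g)), crd b 2 (p - g))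
  have hC : Continuous C := by fun_prop
  have hC0 : C g = 0 := by simp [C]
  have hEC : ∀ p, E (C p) = p := fun p => by
    simp only [E, C]
    rw [← sum_crd, add_sub_cancel]
  have hCt : Tendsto C (𝓝 g) (𝓝 0) := by
    rw [← hC0]
    exact hC.continuousAt
  have ev : ∀ᶠ p in 𝓝 g, p ∈ S ↔ crd b 2 (p - g) = f (crd b 0 (p - g), crd b 1 (p - g)) := by
    have hf2 : ∀ᶠ v in 𝓝 (0 : (ℝ × ℝ) × ℝ), f v.1 = ψ v.1 :=
      continuousAt_fst.eventually hfψ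
    filter_upwards [hU.mem_nhds hgU, hCt.eventually hψiff, hCt.eventually hf2] with p hpU h6 h7
    have : p ∈ S ↔ F p = 0 := by
      have h8 : p ∈ S ∩ U ↔ p ∈ {p ∈ U | F p = 0} := by rw [hSU]
      simpa [hpU] using h8
    rw [this]
    simp only [Function.comp_apply, hEC, hE0, hFg] at h6
    rw [h6, eq_comm, ← h7]
  obtain ⟨V, hV, hVo, hgV⟩ := eventually_nhds_iff.1 ev
  refine ⟨f, V, ⟨hf, hVo, hgV, hV⟩, ?_⟩
  exact hfψ.self_of_nhds.trans hψ0

/-! ### Contact of lines with a graph -/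

section

variable {S : Set R3} {g : R3} {b : Module.Basis (Fin 3) ℝ R3} {f : ℝ × ℝ → ℝ} {V : Set R3}

/-- The equation `z - f (x, y)` of the graph of `f`, along the line of direction `v` through the
point of the graph over `p`. -/
noncomputable def graphLine (b : Module.Basis (Fin 3) ℝ R3) (f : ℝ × ℝ → ℝ) (p : ℝ × ℝ) (v : R3)
    (t : ℝ) : ℝ :=
  f p + t * crd b 2 v - f (p.1 + t * crd b 0 v, p.2 + t * crd b 1 v)

theorem contDiff_graphLine (hf : ContDiff ℝ ∞ f) (p : ℝ × ℝ) (v : R3) :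
    ContDiff ℝ ∞ (graphLine b f p v) := by
  unfold graphLine
  fun_prop

theorem hasDerivAt_graphPt_line (hf : ContDiff ℝ ∞ f) (p : ℝ × ℝ) (a c t : ℝ) :
    HasDerivAt (fun t : ℝ => graphPt b g f (p.1 + t * a, p.2 + t * c))
      (a • b 0 + c • b 1 + (px f (p.1 + t * a, p.2 + t * c) * a +
        py f (p.1 + t * a, p.2 + t * c) * c) • b 2) t := by
  have hX : HasDerivAt (fun t : ℝ => p.1 + t * a) a t := by
    simpa using ((hasDerivAt_id t).mul_const a).const_add p.1
  have hY : HasDerivAt (fun t : ℝ => p.2 + t * c) c t := by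
    simpa using ((hasDerivAt_id t).mul_const c).const_add p.2
  exact (((hX.smul_const (b 0)).add (hY.smul_const (b 1))).add
    ((HasDerivAt.comp_partials hf hX hY).smul_const (b 2))).const_add g

theorem IsGraphOn.graphPt_mem_iff (hG : IsGraphOn S g b f V) {p : ℝ × ℝ}
    (hp : graphPt b g f p ∈ V) : graphPt b g f p ∈ S := by
  rw [hG.mem_iff _ hp]
  simp

/-- The contact with a line does not depend on the choice of the equation, so that it can be
computed with the equation of the graph. -/
theorem IsGraphOn.lineContact_iff (hG : IsGraphOn S g b f V) {p : ℝ × ℝ}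
    (hp : graphPt b g f p ∈ V) (v : R3) (k : ℕ) :
    LineContact S (graphPt b g f p) v k ↔
      ∀ j < k, iteratedDeriv j (graphLine b f p v) 0 = 0 := by
  have hf := hG.smooth
  constructor
  · rintro ⟨F, ⟨U, hU, hqU, hFs, hF0, hSU⟩, hj⟩
    have hFa : ContDiffAt ℝ ∞ F (graphPt b g f p) := hFs.contDiffAt (hU.mem_nhds hqU)
    have hvan : ∀ᶠ m in 𝓝 (graphPt b g f p), m ∈ S → F m = 0 := by
      filter_upwards [hU.mem_nhds hqU] with m hmU hmS
      have : m ∈ S ∩ U := ⟨hmS, hmU⟩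
      rw [hSU] at this
      exact this.2
    have hzero : ∀ᶠ p' in 𝓝 p, F (graphPt b g f p') = 0 := by
      have hc : ContinuousAt (graphPt b g f) p := (ContDiff.graphPt hf).continuous.continuousAt
      filter_upwards [hc.eventually hvan, hc.eventually (hG.isOpen.mem_nhds hp)] with p' h1 h2
      exact h1 (hG.graphPt_mem_iff h2)
    have hline : ∀ a c : ℝ, Tendsto (fun t : ℝ => (p.1 + t * a, p.2 + t * c)) (𝓝 0) (𝓝 p) := by
      intro a c
      have : Continuous fun t : ℝ => (p.1 + t * a, p.2 + t * c) := by fun_prop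
      simpa using this.tendsto 0
    have hker : ∀ a c : ℝ, fderiv ℝ F (graphPt b g f p)
        (a • b 0 + c • b 1 + (px f p * a + py f p * c) • b 2) = 0 := by
      intro a c
      have h1 := hasDerivAt_graphPt_line (b := b) (g := g) hf p a c 0
      simp only [zero_mul, add_zero] at h1
      have hFd : HasFDerivAt F (fderiv ℝ F (graphPt b g f p))
          (graphPt b g f (p.1 + 0 * a, p.2 + 0 * c)) := by
        simpa using (hFa.differentiableAt (by simp)).hasFDerivAt
      have h2 := HasFDerivAt.comp_hasDerivAt
        (f := fun t : ℝ => graphPt b g f (p.1 + t * a, p.2 + t * c)) (0 : ℝ) hFd h1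
      have h3 : (F ∘ fun t : ℝ => graphPt b g f (p.1 + t * a, p.2 + t * c)) =ᶠ[𝓝 0]
          fun _ => (0 : ℝ) := (hline a c).eventually hzero
      exact h2.unique ((hasDerivAt_const (0 : ℝ) (0 : ℝ)).congr_of_eventuallyEq h3)
    have hb2 : fderiv ℝ F (graphPt b g f p) (b 2) ≠ 0 := by
      intro h
      have h0 := hker 1 0
      have h1 := hker 0 1
      simp only [map_add, map_smul, h, smul_zero, add_zero, one_smul, zero_smul, zero_add] at h0 h1
      refine hF0 _ hqU ?_
      ext v
      rw [sum_crd (b := b) v]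
      simp [h, h0, h1]
    set A : ℝ → R3 := fun t => graphPt b g f p + t • v with hA
    set M : ℝ → R3 := fun t => graphPt b g f (p.1 + t * crd b 0 v, p.2 + t * crd b 1 v) with hM
    -- `M t` is the point of the graph with the same x and y as the point `A t` of the line.
    have hAM : ∀ t, A t - M t = graphLine b f p v t • b 2 := by
      intro t
      refine ext_crd (b := b) ?_ ?_ ?_ <;> simp [A, M, graphPt, graphLine] <;> ring
    have hAt : Tendsto A (𝓝 0) (𝓝 (graphPt b g f p)) := by
      have : Continuous A := by fun_prop
      simpa [A] using this.tendsto 0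
    have hMt : Tendsto M (𝓝 0) (𝓝 (graphPt b g f p)) :=
      ((ContDiff.graphPt hf).continuous.tendsto p).comp (hline _ _)
    -- Strict differentiability compares F(A) - F(M) with the differential on A - M. Since F(M) = 0,
    -- `F` on the line equals `graphLine` times the nonzero number dF(b 2), up to a smaller term, so
    -- both functions have the same order of vanishing.
    have hst := (hFa.hasStrictFDerivAt (by simp)).isLittleO.comp_tendsto (hAt.prodMk_nhds hMt)
    have hM0 : ∀ᶠ t in 𝓝 (0 : ℝ), F (M t) = 0 := (hline _ _).eventually hzero
    have hst2 : (fun t => F (A t) - graphLine b f p v t * fderiv ℝ F (graphPt b g f p) (b 2))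
        =o[𝓝 0] fun t => graphLine b f p v t * fderiv ℝ F (graphPt b g f p) (b 2) := by
      have h1 : (fun t => F (A t) - graphLine b f p v t * fderiv ℝ F (graphPt b g f p) (b 2))
          =o[𝓝 0] fun t => graphLine b f p v t • b 2 := by
        refine hst.congr' ?_ ?_
        · filter_upwards [hM0] with t ht
          simp only [Function.comp_apply, ht, hAM, map_smul, smul_eq_mul, sub_zero]
        · filter_upwards with t
          simp only [Function.comp_apply, hAM]
      refine h1.trans_isBigO (Asymptotics.IsBigO.of_bound
        (‖b 2‖ / ‖fderiv ℝ F (graphPt b g f p) (b 2)‖) (Eventually.of_forall fun t => ?_))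
      have : ‖fderiv ℝ F (graphPt b g f p) (b 2)‖ ≠ 0 := norm_ne_zero_iff.2 hb2
      rw [norm_smul, norm_mul]
      field_simp
      exact le_rfl
    have hbig : (fun t => graphLine b f p v t * fderiv ℝ F (graphPt b g f p) (b 2)) =O[𝓝 0]
        fun t => F (A t) := by
      simpa using hst2.right_isBigO_add
    have hFA : ContDiffAt ℝ k (fun t => F (A t)) 0 := by
      have h1 : ContDiffAt ℝ ∞ A 0 := by fun_prop
      have h2 : ContDiffAt ℝ ∞ F (A 0) := by simpa [A] using hFa
      exact (h2.comp 0 h1).of_le (by exact_mod_cast le_top)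
    have hgl : ContDiffAt ℝ k (graphLine b f p v) 0 :=
      (contDiff_graphLine hf p v).contDiffAt.of_le (by exact_mod_cast le_top)
    rw [iteratedDeriv_eq_zero_iff_isBigO_pow hgl]
    rw [iteratedDeriv_eq_zero_iff_isBigO_pow hFA] at hj
    have h5 := hbig.trans hj
    refine (Asymptotics.isBigO_const_mul_left_iff hb2).1 (h5.congr_left fun t => mul_comm _ _)
  -- Conversely, z - f(x, y) is itself a regular local equation.
  · intro h
    refine ⟨fun m => crd b 2 (m - g) - f (crd b 0 (m - g), crd b 1 (m - g)),
      ⟨V, hG.isOpen, hp, ?_, ?_, ?_⟩, ?_⟩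
    · refine ContDiff.contDiffOn ?_
      fun_prop
    · intro m _ h0
      have h1 : HasDerivAt (fun t : ℝ => m + t • b 2) (b 2) 0 := by
        have := ((hasDerivAt_id (0 : ℝ)).smul_const (b 2)).const_add m
        rwa [one_smul] at this
      have hd : DifferentiableAt ℝ
          (fun m => crd b 2 (m - g) - f (crd b 0 (m - g), crd b 1 (m - g))) (m + (0 : ℝ) • b 2) :=
        (ContDiff.differentiable (n := ∞) (by fun_prop) (by simp)) _
      have h2 := HasFDerivAt.comp_hasDerivAt (f := fun t : ℝ => m + t • b 2) (0 : ℝ)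
        hd.hasFDerivAt h1
      rw [zero_smul, add_zero, h0] at h2
      have h3 : ((fun m => crd b 2 (m - g) - f (crd b 0 (m - g), crd b 1 (m - g))) ∘
          fun t : ℝ => m + t • b 2) = fun t => t + (crd b 2 (m - g) -
            f (crd b 0 (m - g), crd b 1 (m - g))) := by
        ext t
        simp [map_sub]
        ring
      rw [h3] at h2
      have h4 := h2.unique ((hasDerivAt_id (0 : ℝ)).add_const _)
      simp at h4
    · ext m
      simp only [mem_inter_iff, mem_ofPred_eq, sub_eq_zero]
      exact ⟨fun hm => ⟨hm.2, (hG.mem_iff m hm.2).1 hm.1⟩,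
        fun hm => ⟨(hG.mem_iff m hm.1).2 hm.2, hm.1⟩⟩
    · intro j hjk
      have he : graphLine b f p v = fun t => crd b 2 (graphPt b g f p + t • v - g) -
          f (crd b 0 (graphPt b g f p + t • v - g), crd b 1 (graphPt b g f p + t • v - g)) := by
        ext t
        simp [add_sub_right_comm, graphLine]
      rw [← he]
      exact h j hjk

/-- The second differential of `f` at `p`, on the vector `(a, c)`. -/
noncomputable def quad (f : ℝ × ℝ → ℝ) (p : ℝ × ℝ) (a c : ℝ) : ℝ :=
  px (px f) p * a ^ 2 + 2 * px (py f) p * a * c + py (py f) p * c ^ 2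

/-- The third differential of `f` at `p`, on the vector `(a, c)`. -/
noncomputable def cubic (f : ℝ × ℝ → ℝ) (p : ℝ × ℝ) (a c : ℝ) : ℝ :=
  px (px (px f)) p * a ^ 3 + 3 * px (px (py f)) p * a ^ 2 * c + 3 * px (py (py f)) p * a * c ^ 2 +
    py (py (py f)) p * c ^ 3

theorem hasDerivAt_line (hf : ContDiff ℝ ∞ f) (p : ℝ × ℝ) (a c t : ℝ) :
    HasDerivAt (fun t : ℝ => f (p.1 + t * a, p.2 + t * c))
      (px f (p.1 + t * a, p.2 + t * c) * a + py f (p.1 + t * a, p.2 + t * c) * c) t := by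
  have hX : HasDerivAt (fun t : ℝ => p.1 + t * a) a t := by
    simpa using ((hasDerivAt_id t).mul_const a).const_add p.1
  have hY : HasDerivAt (fun t : ℝ => p.2 + t * c) c t := by
    simpa using ((hasDerivAt_id t).mul_const c).const_add p.2
  exact HasDerivAt.comp_partials hf hX hY

theorem deriv_graphLine (hf : ContDiff ℝ ∞ f) (p : ℝ × ℝ) (v : R3) :
    deriv (graphLine b f p v) = fun t => crd b 2 v -
      (px f (p.1 + t * crd b 0 v, p.2 + t * crd b 1 v) * crd b 0 v +
        py f (p.1 + t * crd b 0 v, p.2 + t * crd b 1 v) * crd b 1 v) := by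
  ext t
  have h := (((hasDerivAt_id t).mul_const (crd b 2 v)).const_add (f p)).sub
    (hasDerivAt_line hf p (crd b 0 v) (crd b 1 v) t)
  simp only [one_mul] at h
  exact h.deriv

theorem deriv_deriv_graphLine (hf : ContDiff ℝ ∞ f) (p : ℝ × ℝ) (v : R3) :
    deriv (deriv (graphLine b f p v)) = fun t =>
      -quad f (p.1 + t * crd b 0 v, p.2 + t * crd b 1 v) (crd b 0 v) (crd b 1 v) := by
  rw [deriv_graphLine hf]
  ext t
  have h := (((hasDerivAt_line hf.px p (crd b 0 v) (crd b 1 v) t).mul_const (crd b 0 v)).add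
    ((hasDerivAt_line hf.py p (crd b 0 v) (crd b 1 v) t).mul_const (crd b 1 v))).const_sub
    (crd b 2 v)
  refine h.deriv.trans ?_
  rw [py_px hf, quad]
  ring

theorem deriv_deriv_deriv_graphLine (hf : ContDiff ℝ ∞ f) (p : ℝ × ℝ) (v : R3) :
    deriv (deriv (deriv (graphLine b f p v))) = fun t =>
      -cubic f (p.1 + t * crd b 0 v, p.2 + t * crd b 1 v) (crd b 0 v) (crd b 1 v) := by
  rw [deriv_deriv_graphLine hf]
  ext t
  have h1 := (hasDerivAt_line hf.px.px p (crd b 0 v) (crd b 1 v) t).mul_const (crd b 0 v ^ 2)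
  have h2 := (((hasDerivAt_line hf.py.px p (crd b 0 v) (crd b 1 v) t).const_mul 2).mul_const
    (crd b 0 v)).mul_const (crd b 1 v)
  have h3 := (hasDerivAt_line hf.py.py p (crd b 0 v) (crd b 1 v) t).mul_const (crd b 1 v ^ 2)
  refine ((h1.add h2).add h3).neg.deriv.trans ?_
  rw [py_px hf.px, py_px hf.py, py_px hf, cubic]
  ring

theorem iteratedDeriv_zero_graphLine (p : ℝ × ℝ) (v : R3) :
    iteratedDeriv 0 (graphLine b f p v) 0 = 0 := by
  simp [graphLine]

theorem iteratedDeriv_one_graphLine (hf : ContDiff ℝ ∞ f) (p : ℝ × ℝ) (v : R3) :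
    iteratedDeriv 1 (graphLine b f p v) 0 =
      crd b 2 v - (px f p * crd b 0 v + py f p * crd b 1 v) := by
  rw [iteratedDeriv_one, deriv_graphLine hf]
  simp

theorem iteratedDeriv_two_graphLine (hf : ContDiff ℝ ∞ f) (p : ℝ × ℝ) (v : R3) :
    iteratedDeriv 2 (graphLine b f p v) 0 = -quad f p (crd b 0 v) (crd b 1 v) := by
  rw [iteratedDeriv_succ, iteratedDeriv_one, deriv_deriv_graphLine hf]
  simp

theorem iteratedDeriv_three_graphLine (hf : ContDiff ℝ ∞ f) (p : ℝ × ℝ) (v : R3) :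
    iteratedDeriv 3 (graphLine b f p v) 0 = -cubic f p (crd b 0 v) (crd b 1 v) := by
  rw [iteratedDeriv_succ, iteratedDeriv_succ, iteratedDeriv_one, deriv_deriv_deriv_graphLine hf]
  simp

theorem IsGraphOn.isTangentVector_iff (hG : IsGraphOn S g b f V) {p : ℝ × ℝ}
    (hp : graphPt b g f p ∈ V) (v : R3) : IsTangentVector S (graphPt b g f p) v ↔
      crd b 2 v = px f p * crd b 0 v + py f p * crd b 1 v := by
  rw [IsTangentVector, hG.lineContact_iff hp, ← sub_eq_zero (a := crd b 2 v),
    ← iteratedDeriv_one_graphLine hG.smooth]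
  refine ⟨fun h => h 1 (by simp), fun h j hj => ?_⟩
  interval_cases j
  exacts [iteratedDeriv_zero_graphLine p v, h]

theorem IsGraphOn.isAsymptoticVector_iff (hG : IsGraphOn S g b f V) {p : ℝ × ℝ}
    (hp : graphPt b g f p ∈ V) (v : R3) : IsAsymptoticVector S (graphPt b g f p) v ↔
      crd b 2 v = px f p * crd b 0 v + py f p * crd b 1 v ∧
        quad f p (crd b 0 v) (crd b 1 v) = 0 := by
  rw [IsAsymptoticVector, hG.lineContact_iff hp, ← sub_eq_zero (a := crd b 2 v),
    ← iteratedDeriv_one_graphLine hG.smooth, ← neg_eq_zero (a := quad _ _ _ _),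
    ← iteratedDeriv_two_graphLine hG.smooth]
  refine ⟨fun h => ⟨h 1 (by simp), h 2 (by simp)⟩, fun h j hj => ?_⟩
  interval_cases j
  exacts [iteratedDeriv_zero_graphLine p v, h.1, h.2]

theorem IsGraphOn.lineContact_four_iff (hG : IsGraphOn S g b f V) {p : ℝ × ℝ}
    (hp : graphPt b g f p ∈ V) (v : R3) : LineContact S (graphPt b g f p) v 4 ↔
      crd b 2 v = px f p * crd b 0 v + py f p * crd b 1 v ∧
        quad f p (crd b 0 v) (crd b 1 v) = 0 ∧ cubic f p (crd b 0 v) (crd b 1 v) = 0 := by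
  rw [hG.lineContact_iff hp, ← sub_eq_zero (a := crd b 2 v),
    ← iteratedDeriv_one_graphLine hG.smooth, ← neg_eq_zero (a := quad _ _ _ _),
    ← iteratedDeriv_two_graphLine hG.smooth, ← neg_eq_zero (a := cubic _ _ _ _),
    ← iteratedDeriv_three_graphLine hG.smooth]
  refine ⟨fun h => ⟨h 1 (by simp), h 2 (by simp), h 3 (by simp)⟩, fun h j hj => ?_⟩
  interval_cases j
  exacts [iteratedDeriv_zero_graphLine p v, h.1, h.2.1, h.2.2]

end

/-! ### Asymptotic directions and the sign of the Hessian -/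

/-- The Hessian determinant. -/
noncomputable def hess (f : ℝ × ℝ → ℝ) (p : ℝ × ℝ) : ℝ :=
  px (px f) p * py (py f) p - px (py f) p ^ 2

/-- The vector tangent to the graph of `f` at the point over `p`, with projection `(a, c)`. -/
noncomputable def graphVec (b : Module.Basis (Fin 3) ℝ R3) (f : ℝ × ℝ → ℝ) (p : ℝ × ℝ)
    (a c : ℝ) : R3 := a • b 0 + c • b 1 + (px f p * a + py f p * c) • b 2

section

variable {S : Set R3} {g : R3} {b : Module.Basis (Fin 3) ℝ R3} {f : ℝ × ℝ → ℝ} {V : Set R3}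
  {p : ℝ × ℝ}

theorem contDiff_hess (hf : ContDiff ℝ ∞ f) : ContDiff ℝ ∞ (hess f) := by
  unfold hess
  fun_prop

@[simp] theorem crd_zero_graphVec (a c : ℝ) : crd b 0 (graphVec b f p a c) = a := by
  simp [graphVec]

@[simp] theorem crd_one_graphVec (a c : ℝ) : crd b 1 (graphVec b f p a c) = c := by
  simp [graphVec]

@[simp] theorem crd_two_graphVec (a c : ℝ) :
    crd b 2 (graphVec b f p a c) = px f p * a + py f p * c := by
  simp [graphVec]

theorem graphVec_ne_zero {a : ℝ} (c : ℝ) (ha : a ≠ 0) : graphVec b f p a c ≠ 0 := fun h =>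
  ha (by simpa using congrArg (crd b 0) h)

theorem smul_graphVec (s a c : ℝ) : s • graphVec b f p a c = graphVec b f p (s * a) (s * c) := by
  refine ext_crd (b := b) ?_ ?_ ?_ <;> simp
  ring

theorem eq_graphVec {v : R3} (h : crd b 2 v = px f p * crd b 0 v + py f p * crd b 1 v) :
    v = graphVec b f p (crd b 0 v) (crd b 1 v) :=
  ext_crd (b := b) (by simp) (by simp) (by simp [h])

/-- Completing the square where f_yy ≠ 0. The number and the slopes of the asymptotic lines are read
off from this identity. -/
theorem quad_mul_py_py (f : ℝ × ℝ → ℝ) (p : ℝ × ℝ) (a c : ℝ) :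
    quad f p a c * py (py f) p =
      (py (py f) p * c + px (py f) p * a) ^ 2 + hess f p * a ^ 2 := by
  rw [quad, hess]
  ring

theorem IsGraphOn.isAsymptoticVector_graphVec (hG : IsGraphOn S g b f V)
    (hp : graphPt b g f p ∈ V) (a c : ℝ) :
    IsAsymptoticVector S (graphPt b g f p) (graphVec b f p a c) ↔ quad f p a c = 0 := by
  rw [hG.isAsymptoticVector_iff hp]
  simp

/-- Both terms of the completed square are nonnegative, so both vanish; the first one fixes the
slope. -/
theorem eq_smul_graphVec_of_hess_nonneg (hyy : py (py f) p ≠ 0) (hh : 0 ≤ hess f p) {v : R3}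
    (h : crd b 2 v = px f p * crd b 0 v + py f p * crd b 1 v)
    (hq : quad f p (crd b 0 v) (crd b 1 v) = 0) :
    v = crd b 0 v • graphVec b f p 1 (-px (py f) p / py (py f) p) := by
  have h1 := quad_mul_py_py f p (crd b 0 v) (crd b 1 v)
  rw [hq, zero_mul] at h1
  have h2 : (py (py f) p * crd b 1 v + px (py f) p * crd b 0 v) ^ 2 = 0 := by
    have := mul_nonneg hh (sq_nonneg (crd b 0 v))
    nlinarith [sq_nonneg (py (py f) p * crd b 1 v + px (py f) p * crd b 0 v)]
  have h3 := pow_eq_zero_iff (two_ne_zero) |>.1 h2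
  conv_lhs => rw [eq_graphVec h]
  rw [smul_graphVec, mul_one]
  congr 1
  field_simp
  linarith

theorem quad_root_eq_zero (hyy : py (py f) p ≠ 0) (hh : hess f p ≤ 0) {σ : ℝ} (hσ : σ ^ 2 = 1) :
    quad f p 1 ((-px (py f) p + σ * √(-hess f p)) / py (py f) p) = 0 := by
  have h1 := quad_mul_py_py f p 1 ((-px (py f) p + σ * √(-hess f p)) / py (py f) p)
  have h2 : √(-hess f p) ^ 2 = -hess f p := Real.sq_sqrt (by linarith)
  have h3 : py (py f) p * ((-px (py f) p + σ * √(-hess f p)) / py (py f) p) =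
    -px (py f) p + σ * √(-hess f p) := by field_simp
  rw [h3] at h1
  refine (mul_eq_zero.1 (h1.trans ?_)).resolve_right hyy
  ring_nf
  rw [hσ, h2]
  ring

theorem IsGraphOn.hyperbolic_iff (hG : IsGraphOn S g b f V) (hp : graphPt b g f p ∈ V)
    (hyy : py (py f) p ≠ 0) : graphPt b g f p ∈ hyperbolicDomain S ↔ hess f p < 0 := by
  constructor
  · rintro ⟨-, v₁, v₂, hli, hv⟩
    by_contra! hh
    have h1 := (hG.isAsymptoticVector_iff hp v₁).1
      ((hv v₁).2 (Or.inl (Submodule.mem_span_singleton_self v₁)))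
    have h2 := (hG.isAsymptoticVector_iff hp v₂).1
      ((hv v₂).2 (Or.inr (Submodule.mem_span_singleton_self v₂)))
    have e1 := eq_smul_graphVec_of_hess_nonneg hyy hh h1.1 h1.2
    have e2 := eq_smul_graphVec_of_hess_nonneg hyy hh h2.1 h2.2
    rw [LinearIndependent.pair_iff] at hli
    -- Two vectors proportional to the same one satisfy this cross relation, against their
    -- independence.
    have h3 := hli (crd b 0 v₂) (-crd b 0 v₁) (by
      calc _ = crd b 0 v₂ • (crd b 0 v₁ • graphVec b f p 1 (-px (py f) p / py (py f) p)) +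
            -crd b 0 v₁ • (crd b 0 v₂ • graphVec b f p 1 (-px (py f) p / py (py f) p)) := by
              rw [← e1, ← e2]
        _ = 0 := by module)
    have h5 : v₁ = 0 := by
      rw [e1, neg_eq_zero.1 h3.2, zero_smul]
    have := hli 1 0 (by simp [h5])
    simp at this
  · intro hh
    set r : ℝ → ℝ := fun σ => (-px (py f) p + σ * √(-hess f p)) / py (py f) p with hr
    have hs : 0 < √(-hess f p) := Real.sqrt_pos.2 (by linarith)
    have hne : r 1 ≠ r (-1) := by
      simp only [r]
      intro h
      field_simp at h
      linarith
    refine ⟨hG.graphPt_mem_iff hp, graphVec b f p 1 (r 1), graphVec b f p 1 (r (-1)), ?_, ?_⟩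
    · rw [LinearIndependent.pair_iff]
      intro s t hst
      have h0 := congrArg (crd b 0) hst
      have h1 := congrArg (crd b 1) hst
      simp only [map_add, map_smul, crd_zero_graphVec, crd_one_graphVec, smul_eq_mul, mul_one,
        map_zero] at h0 h1
      have h2 : s * (r 1 - r (-1)) = 0 := by linear_combination h1 - r (-1) * h0
      have h3 : s = 0 := (mul_eq_zero.1 h2).resolve_right (sub_ne_zero.2 hne)
      exact ⟨h3, by linarith⟩
    · intro v
      rw [hG.isAsymptoticVector_iff hp, Submodule.mem_span_singleton, Submodule.mem_span_singleton]
      constructor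
      · rintro ⟨ht, hq⟩
        have h1 := quad_mul_py_py f p (crd b 0 v) (crd b 1 v)
        have h2 : √(-hess f p) ^ 2 = -hess f p := Real.sq_sqrt (by linarith)
        rw [hq, zero_mul] at h1
        -- The completed square is a difference of two squares when the Hessian is negative; each
        -- factor is one asymptotic line.
        have h3 : (py (py f) p * crd b 1 v + px (py f) p * crd b 0 v - √(-hess f p) * crd b 0 v) *
            (py (py f) p * crd b 1 v + px (py f) p * crd b 0 v + √(-hess f p) * crd b 0 v) = 0 := by
          linear_combination -h1 - crd b 0 v ^ 2 * h2
        rcases mul_eq_zero.1 h3 with h4 | h4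
        · left
          refine ⟨crd b 0 v, ?_⟩
          rw [smul_graphVec, mul_one]
          conv_rhs => rw [eq_graphVec ht]
          congr 1
          simp only [r]
          field_simp
          linarith
        · right
          refine ⟨crd b 0 v, ?_⟩
          rw [smul_graphVec, mul_one]
          conv_rhs => rw [eq_graphVec ht]
          congr 1
          simp only [r]
          field_simp
          linarith
      · rintro (⟨a, rfl⟩ | ⟨a, rfl⟩) <;> rw [← hG.isAsymptoticVector_iff hp, smul_graphVec,
          hG.isAsymptoticVector_graphVec hp]
        · have := quad_root_eq_zero (f := f) (p := p) hyy hh.le (σ := 1) (by norm_num)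
          change quad f p 1 (r 1) = 0 at this
          rw [show quad f p (a * 1) (a * r 1) = a ^ 2 * quad f p 1 (r 1) by rw [quad, quad]; ring,
            this, mul_zero]
        · have := quad_root_eq_zero (f := f) (p := p) hyy hh.le (σ := -1) (by norm_num)
          change quad f p 1 (r (-1)) = 0 at this
          rw [show quad f p (a * 1) (a * r (-1)) = a ^ 2 * quad f p 1 (r (-1)) by
            rw [quad, quad]; ring, this, mul_zero]

/-- A negative Hessian gives two asymptotic directions with different slopes, a positive one gives
none. -/
theorem IsGraphOn.hess_eq_zero_of_parabolic (hG : IsGraphOn S g b f V) (hp : graphPt b g f p ∈ V)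
    (hyy : py (py f) p ≠ 0) (h : graphPt b g f p ∈ parabolicCurve S) : hess f p = 0 := by
  obtain ⟨-, v, hv0, hv⟩ := h
  rcases lt_trichotomy (hess f p) 0 with hh | hh | hh
  · have hs : 0 < √(-hess f p) := Real.sqrt_pos.2 (by linarith)
    have h1 := (hv _).1 ((hG.isAsymptoticVector_graphVec hp _ _).2
      (quad_root_eq_zero hyy hh.le (σ := 1) (by norm_num)))
    have h2 := (hv _).1 ((hG.isAsymptoticVector_graphVec hp _ _).2
      (quad_root_eq_zero hyy hh.le (σ := -1) (by norm_num)))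
    obtain ⟨s, hs1⟩ := Submodule.mem_span_singleton.1 h1
    obtain ⟨t, ht1⟩ := Submodule.mem_span_singleton.1 h2
    have e1 := congrArg (crd b 0) hs1
    have e2 := congrArg (crd b 0) ht1
    simp only [map_smul, crd_zero_graphVec, smul_eq_mul] at e1 e2
    have hst : s = t := by
      have : crd b 0 v ≠ 0 := by
        rintro h
        simp [h] at e1
      exact mul_right_cancel₀ this (e1.trans e2.symm)
    rw [hst, ht1] at hs1
    have e3 := congrArg (crd b 1) hs1
    simp only [crd_one_graphVec] at e3
    field_simp at e3
    linarith
  · exact hh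
  · exfalso
    obtain ⟨ht, hq⟩ := (hG.isAsymptoticVector_iff hp v).1
      ((hv v).2 (Submodule.mem_span_singleton_self v))
    have h1 := quad_mul_py_py f p (crd b 0 v) (crd b 1 v)
    rw [hq, zero_mul] at h1
    have h2 : crd b 0 v = 0 := by
      by_contra hne
      have : 0 < hess f p * crd b 0 v ^ 2 := by positivity
      nlinarith [sq_nonneg (py (py f) p * crd b 1 v + px (py f) p * crd b 0 v)]
    have := eq_smul_graphVec_of_hess_nonneg hyy hh.le ht hq
    rw [h2, zero_smul] at this
    exact hv0 this

end

/-! ### Orientation and the twist of the tangent plane -/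

section

variable {S : Set R3} {g : R3} {b : Module.Basis (Fin 3) ℝ R3} {f : ℝ × ℝ → ℝ} {V : Set R3}
  {p : ℝ × ℝ}

theorem basis_det_eq (u v w : R3) : b.det ![u, v, w] =
    crd b 0 u * crd b 1 v * crd b 2 w - crd b 0 u * crd b 1 w * crd b 2 v -
      crd b 0 v * crd b 1 u * crd b 2 w + crd b 0 v * crd b 1 w * crd b 2 u +
      crd b 0 w * crd b 1 u * crd b 2 v - crd b 0 w * crd b 1 v * crd b 2 u := by
  rw [Module.Basis.det_apply, Matrix.det_fin_three]
  simp only [Module.Basis.toMatrix_apply, Matrix.cons_val_zero, Matrix.cons_val_one,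
    Matrix.cons_val]
  simp only [← Module.Basis.coord_apply, coord_eq_crd]

theorem exists_basis_of_det_ne_zero {u v w : R3} (h : b.det ![u, v, w] ≠ 0) :
    ∃ b' : Module.Basis (Fin 3) ℝ R3, ⇑b' = ![u, v, w] := by
  have := (b.is_basis_iff_det (v := ![u, v, w])).2 (isUnit_iff_ne_zero.2 h)
  exact ⟨Module.Basis.mk this.1 this.2.ge, Module.Basis.coe_mk _ _⟩

theorem isPositiveFrame_iff (u v w : R3) :
    IsPositiveFrame b.orientation u v w ↔ 0 < b.det ![u, v, w] := by
  constructor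
  · rintro ⟨b', hb', ho⟩
    rw [← hb']
    exact (b.orientation_eq_iff_det_pos b').1 ho.symm
  · intro h
    obtain ⟨b', hb'⟩ := exists_basis_of_det_ne_zero h.ne'
    refine ⟨b', hb', ((b.orientation_eq_iff_det_pos b').2 ?_).symm⟩
    rwa [hb']

theorem isPositiveFrame_neg_iff (u v w : R3) :
    IsPositiveFrame (-b.orientation) u v w ↔ b.det ![u, v, w] < 0 := by
  constructor
  · rintro ⟨b', hb', ho⟩
    rw [← hb']
    have h1 : b'.orientation ≠ b.orientation := by
      rw [ho]
      exact (Module.Ray.ne_neg_self _).symm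
    have h2 := mt (b.orientation_eq_iff_det_pos b').2 h1.symm
    exact lt_of_le_of_ne (not_lt.1 h2) (b.isUnit_det b').ne_zero
  · intro h
    obtain ⟨b', hb'⟩ := exists_basis_of_det_ne_zero h.ne
    refine ⟨b', hb', (b.orientation_eq_or_eq_neg b'.orientation).elim (fun ho => ?_) ?_⟩
    · have := (b.orientation_eq_iff_det_pos b').1 ho.symm
      rw [hb'] at this
      exact absurd this h.not_gt
    · exact fun ho => ho

/-- A curve on `S` through `V` is recovered from its projection. -/
theorem IsGraphOn.curve_eq (hG : IsGraphOn S g b f V) {γ : ℝ → R3} {t : ℝ} (hV : γ t ∈ V)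
    (hS : γ t ∈ S) : γ t = graphPt b g f (crd b 0 (γ t - g), crd b 1 (γ t - g)) :=
  eq_graphPt ((hG.mem_iff _ hV).1 hS)

/-- The determinant that defines the twist of the tangent plane along a curve. -/
theorem IsGraphOn.twist_det (hG : IsGraphOn S g b f V) (hp : graphPt b g f p ∈ V)
    {γ w : ℝ → R3} {ε : ℝ} (hε : 0 < ε) (hγ : ContDiffOn ℝ ∞ γ (Ioo (-ε) ε))
    (hw : ContDiffOn ℝ ∞ w (Ioo (-ε) ε)) (hγ0 : γ 0 = graphPt b g f p) {a c : ℝ}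
    (hv : deriv γ 0 = graphVec b f p a c)
    (hS : ∀ t ∈ Ioo (-ε) ε, γ t ∈ S ∧ IsTangentVector S (γ t) (w t)) (ha : a ≠ 0)
    (hq : quad f p a c = 0) :
    b.det ![graphVec b f p a c, w 0, deriv w 0] =
      (a * crd b 1 (w 0) - c * crd b 0 (w 0)) ^ 2 / a ^ 2 *
        (a * (px (py f) p * a + py (py f) p * c)) := by
  have hf := hG.smooth
  have h0 : (0 : ℝ) ∈ Ioo (-ε) ε := ⟨by linarith, hε⟩
  have hnh : Ioo (-ε) ε ∈ 𝓝 (0 : ℝ) := isOpen_Ioo.mem_nhds h0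
  have dγ : HasDerivAt γ (graphVec b f p a c) 0 := by
    rw [← hv]
    exact ((hγ.contDiffAt hnh).differentiableAt (by simp)).hasDerivAt
  have dw : HasDerivAt w (deriv w 0) 0 :=
    ((hw.contDiffAt hnh).differentiableAt (by simp)).hasDerivAt
  have dX : HasDerivAt (fun t => crd b 0 (γ t - g)) a 0 := by
    have := (crd b 0).hasFDerivAt.comp_hasDerivAt (0 : ℝ) (dγ.sub_const g)
    rwa [crd_zero_graphVec] at this
  have dY : HasDerivAt (fun t => crd b 1 (γ t - g)) c 0 := by
    have := (crd b 1).hasFDerivAt.comp_hasDerivAt (0 : ℝ) (dγ.sub_const g)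
    rwa [crd_one_graphVec] at this
  have dW : ∀ i, HasDerivAt (fun t => crd b i (w t)) (crd b i (deriv w 0)) 0 := fun i =>
    (crd b i).hasFDerivAt.comp_hasDerivAt (0 : ℝ) dw
  have hX0 : (crd b 0 (γ 0 - g), crd b 1 (γ 0 - g)) = p := by simp [hγ0]
  have hγV : ∀ᶠ t in 𝓝 (0 : ℝ), γ t ∈ V := by
    have := dγ.continuousAt
    exact this.eventually (by rw [hγ0]; exact hG.isOpen.mem_nhds hp)
  -- Tangency of `w` is the linear relation w_z = f_x w_x + f_y w_y along the curve. Its derivative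
  -- at 0 involves the curve only through its velocity, which is why the sign of the determinant is
  -- independent of the choices.
  have htan : (fun t => crd b 2 (w t)) =ᶠ[𝓝 0] fun t =>
      px f (crd b 0 (γ t - g), crd b 1 (γ t - g)) * crd b 0 (w t) +
      py f (crd b 0 (γ t - g), crd b 1 (γ t - g)) * crd b 1 (w t) := by
    filter_upwards [hγV, hnh] with t htV ht
    have e := hG.curve_eq htV (hS t ht).1
    have := (hS t ht).2
    rw [e] at this htV
    exact (hG.isTangentVector_iff htV _).1 this
  have e1 := ((HasDerivAt.comp_partials hf.px dX dY).mul (dW 0)).add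
    ((HasDerivAt.comp_partials hf.py dX dY).mul (dW 1))
  have e2 := (dW 2).unique (e1.congr_of_eventuallyEq htan)
  have e3 := htan.self_of_nhds
  simp only [hX0, py_px hf] at e2 e3
  rw [basis_det_eq, crd_zero_graphVec, crd_one_graphVec, crd_two_graphVec, e2, e3]
  rw [quad] at hq
  field_simp
  linear_combination (a * crd b 1 (w 0) * crd b 0 (w 0) - c * crd b 0 (w 0) ^ 2) * hq

/-- The predicate `P` stands for "positive" or "negative", so that right and left lines are treated
at once: the determinant of `IsGraphOn.twist_det` is a square times the quantity tested. -/
theorem IsGraphOn.rightAsymptotic_iff_aux (hG : IsGraphOn S g b f V) (hp : graphPt b g f p ∈ V)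
    {P : ℝ → Prop} {o : Orientation ℝ R3 (Fin 3)}
    (hP : ∀ u v w, IsPositiveFrame o u v w ↔ P (b.det ![u, v, w]))
    (hPm : ∀ s t, 0 ≤ s → P (s * t) → P t) (hPm' : ∀ s t, 0 < s → P t → P (s * t))
    (hyp : graphPt b g f p ∈ hyperbolicDomain S) {a c : ℝ} (ha : a ≠ 0)
    (hq : quad f p a c = 0) :
    IsRightAsymptotic o S (graphPt b g f p) (graphVec b f p a c) ↔
      P (a * (px (py f) p * a + py (py f) p * c)) := by
  have hf := hG.smooth
  constructor
  · rintro ⟨-, -, γ, w, ε, hε, hγ, hw, hγ0, hv, hS, hfr⟩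
    rw [hP, hG.twist_det hp hε hγ hw hγ0 hv hS ha hq] at hfr
    exact hPm _ _ (by positivity) hfr
  · intro h
    -- Witnesses: the curve over a straight line of direction (a, c), and the tangent field over
    -- e_y. The square factor of `IsGraphOn.twist_det` is then 1.
    have hγs : ContDiff ℝ ∞ (fun t : ℝ => graphPt b g f (p.1 + t * a, p.2 + t * c)) :=
      (ContDiff.graphPt hf).comp (by fun_prop : ContDiff ℝ ∞ fun t : ℝ => (p.1 + t * a, p.2 + t * c))
    have hws : ContDiff ℝ ∞ (fun t : ℝ => graphVec b f (p.1 + t * a, p.2 + t * c) 0 1) := by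
      unfold graphVec
      fun_prop
    have hV : ∀ᶠ t in 𝓝 (0 : ℝ), graphPt b g f (p.1 + t * a, p.2 + t * c) ∈ V :=
      hγs.continuous.continuousAt.eventually (by simpa using hG.isOpen.mem_nhds hp)
    obtain ⟨ε, hε, hεV⟩ := Metric.eventually_nhds_iff_ball.1 hV
    rw [Real.ball_zero_eq_Ioo] at hεV
    have hv : deriv (fun t : ℝ => graphPt b g f (p.1 + t * a, p.2 + t * c)) 0 =
        graphVec b f p a c := by
      rw [(hasDerivAt_graphPt_line hf p a c 0).deriv]
      simp [graphVec]
    have hγ0 : (fun t : ℝ => graphPt b g f (p.1 + t * a, p.2 + t * c)) 0 = graphPt b g f p := by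
      simp
    have hS : ∀ t ∈ Ioo (-ε) ε, graphPt b g f (p.1 + t * a, p.2 + t * c) ∈ S ∧
        IsTangentVector S (graphPt b g f (p.1 + t * a, p.2 + t * c))
          (graphVec b f (p.1 + t * a, p.2 + t * c) 0 1) := fun t ht =>
      ⟨hG.graphPt_mem_iff (hεV t ht), (hG.isTangentVector_iff (hεV t ht) _).2 (by simp)⟩
    refine ⟨hyp, (hG.isAsymptoticVector_graphVec hp a c).2 hq, _, _, ε, hε, hγs.contDiffOn,
      hws.contDiffOn, hγ0, hv, hS, ?_⟩
    rw [hP, hG.twist_det hp hε hγs.contDiffOn hws.contDiffOn hγ0 hv hS ha hq]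
    refine hPm' _ _ ?_ h
    simp
    positivity

/-- The asymptotic line is right where the tangent plane twists positively. -/
theorem IsGraphOn.rightAsymptotic_iff (hG : IsGraphOn S g b f V) (hp : graphPt b g f p ∈ V)
    (hyp : graphPt b g f p ∈ hyperbolicDomain S) {a c : ℝ} (ha : a ≠ 0)
    (hq : quad f p a c = 0) :
    IsRightAsymptotic b.orientation S (graphPt b g f p) (graphVec b f p a c) ↔
      0 < a * (px (py f) p * a + py (py f) p * c) :=
  hG.rightAsymptotic_iff_aux hp isPositiveFrame_iff (fun _ _ hs h => pos_of_mul_pos_right h hs)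
    (fun _ _ hs h => mul_pos hs h) hyp ha hq

theorem IsGraphOn.leftAsymptotic_iff (hG : IsGraphOn S g b f V) (hp : graphPt b g f p ∈ V)
    (hyp : graphPt b g f p ∈ hyperbolicDomain S) {a c : ℝ} (ha : a ≠ 0)
    (hq : quad f p a c = 0) :
    IsLeftAsymptotic b.orientation S (graphPt b g f p) (graphVec b f p a c) ↔
      a * (px (py f) p * a + py (py f) p * c) < 0 :=
  hG.rightAsymptotic_iff_aux (P := fun s => s < 0) hp isPositiveFrame_neg_iff
    (fun _ _ hs h => neg_of_mul_neg_right h hs)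
    (fun _ _ hs h => mul_neg_of_pos_of_neg hs h) hyp ha hq

end

/-! ### Derivatives of the Hessian -/

theorem px_mul {A B : ℝ × ℝ → ℝ} (hA : ContDiff ℝ ∞ A) (hB : ContDiff ℝ ∞ B) (p : ℝ × ℝ) :
    px (fun q => A q * B q) p = px A p * B p + A p * px B p := by
  unfold px
  rw [fderiv_fun_mul (hA.differentiable (by simp) p) (hB.differentiable (by simp) p)]
  simp
  ring

theorem py_mul {A B : ℝ × ℝ → ℝ} (hA : ContDiff ℝ ∞ A) (hB : ContDiff ℝ ∞ B) (p : ℝ × ℝ) :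
    py (fun q => A q * B q) p = py A p * B p + A p * py B p := by
  unfold py
  rw [fderiv_fun_mul (hA.differentiable (by simp) p) (hB.differentiable (by simp) p)]
  simp
  ring

theorem px_add {A B : ℝ × ℝ → ℝ} (hA : ContDiff ℝ ∞ A) (hB : ContDiff ℝ ∞ B) (p : ℝ × ℝ) :
    px (fun q => A q + B q) p = px A p + px B p := by
  unfold px
  rw [fderiv_fun_add (hA.differentiable (by simp) p) (hB.differentiable (by simp) p)]
  simp

theorem px_sub {A B : ℝ × ℝ → ℝ} (hA : ContDiff ℝ ∞ A) (hB : ContDiff ℝ ∞ B) (p : ℝ × ℝ) :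
    px (fun q => A q - B q) p = px A p - px B p := by
  unfold px
  rw [fderiv_fun_sub (hA.differentiable (by simp) p) (hB.differentiable (by simp) p)]
  simp

theorem py_sub {A B : ℝ × ℝ → ℝ} (hA : ContDiff ℝ ∞ A) (hB : ContDiff ℝ ∞ B) (p : ℝ × ℝ) :
    py (fun q => A q - B q) p = py A p - py B p := by
  unfold py
  rw [fderiv_fun_sub (hA.differentiable (by simp) p) (hB.differentiable (by simp) p)]
  simp

section hessian

variable {f : ℝ × ℝ → ℝ}

theorem hess_eq (f : ℝ × ℝ → ℝ) :
    hess f = fun p => px (px f) p * py (py f) p - px (py f) p * px (py f) p := by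
  ext p
  rw [hess, sq]

theorem px_hess (hf : ContDiff ℝ ∞ f) : px (hess f) = fun p =>
    px (px (px f)) p * py (py f) p + px (px f) p * px (py (py f)) p -
      (px (px (py f)) p * px (py f) p + px (py f) p * px (px (py f)) p) := by
  ext p
  rw [hess_eq, px_sub (hf.px.px.mul hf.py.py) (hf.py.px.mul hf.py.px), px_mul hf.px.px hf.py.py,
    px_mul hf.py.px hf.py.px]

theorem py_hess (hf : ContDiff ℝ ∞ f) : py (hess f) = fun p =>
    px (px (py f)) p * py (py f) p + px (px f) p * py (py (py f)) p -
      (px (py (py f)) p * px (py f) p + px (py f) p * px (py (py f)) p) := by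
  ext p
  rw [hess_eq, py_sub (hf.px.px.mul hf.py.py) (hf.py.px.mul hf.py.px), py_mul hf.px.px hf.py.py,
    py_mul hf.py.px hf.py.px, py_px hf.px, py_px hf, py_px hf.py]

theorem px_px_hess (hf : ContDiff ℝ ∞ f) (p : ℝ × ℝ) : px (px (hess f)) p =
    px (px (px (px f))) p * py (py f) p + 2 * px (px (px f)) p * px (py (py f)) p +
      px (px f) p * px (px (py (py f))) p -
      2 * (px (px (px (py f))) p * px (py f) p + px (px (py f)) p ^ 2) := by
  have hf1 := hf.px
  have hf2 := hf.py
  rw [px_hess hf, px_sub (by fun_prop) (by fun_prop), px_add (by fun_prop) (by fun_prop),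
    px_add (by fun_prop) (by fun_prop), px_mul (by fun_prop) (by fun_prop),
    px_mul (by fun_prop) (by fun_prop), px_mul (by fun_prop) (by fun_prop),
    px_mul (by fun_prop) (by fun_prop)]
  ring

end hessian

/-! ### From the geometric hypotheses to the jet of f -/

/-- Two arcs with the same germ of support have parallel velocities. -/
theorem IsArcTangent.exists_smul_eq {C : Set R3} {q v w : R3} (hv : IsArcTangent C q v)
    (hw : IsArcTangent C q w) : ∃ μ : ℝ, v = μ • w := by
  obtain ⟨γ, ε, hε, hγ, hγ0, hγv, -, hγm⟩ := hv
  obtain ⟨δ, η, hη, hδ, hδ0, hδw, hw0, hδm⟩ := hw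
  have dγ : HasDerivAt γ v 0 := by
    rw [← hγv]
    exact ((hγ.contDiffAt (Ioo_mem_nhds (by linarith) hε)).differentiableAt (by simp)).hasDerivAt
  have dδ : HasDerivAt δ w 0 := by
    rw [← hδw]
    exact ((hδ.contDiffAt (Ioo_mem_nhds (by linarith) hη)).differentiableAt (by simp)).hasDerivAt
  -- The orthogonal projection along `w`.
  let L : R3 →L[ℝ] R3 := ContinuousLinearMap.id ℝ R3 -
    (‖w‖ ^ 2)⁻¹ • (innerSL ℝ w).smulRight w
  have hLw : L w = 0 := by
    have : ‖w‖ ≠ 0 := norm_ne_zero_iff.2 hw0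
    simp [L, smul_smul, this]
  have h1 : (fun t => L (δ t - q)) =o[𝓝 0] fun t => δ t - q := by
    have d1 : HasDerivAt (fun t => L (δ t - q)) 0 0 := by
      have := L.hasFDerivAt.comp_hasDerivAt (0 : ℝ) (dδ.sub_const q)
      rwa [hLw] at this
    have h2 : (fun t => L (δ t - q)) =o[𝓝 0] fun t => t := by
      have := d1.isLittleO
      simpa [hδ0] using this
    refine h2.trans_isBigO ?_
    have := dδ.isTheta_sub hw0
    simpa [hδ0, Function.comp_def] using this.isBigO_symm
  -- The estimate is now a property of the filter `𝓝[C] q` alone, which is also the image filter of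
  -- the other arc; transported there, it gives L v = 0.
  have h2 : (fun p => L (p - q)) =o[𝓝[C] q] fun p => p - q := by
    rw [← hδm, Asymptotics.isLittleO_map]
    exact h1
  rw [← hγm, Asymptotics.isLittleO_map] at h2
  have h3 : (fun t => γ t - q) =O[𝓝 0] fun t => t := by
    have := dγ.isBigO_sub
    simpa [hγ0] using this
  have h4 : HasDerivAt (fun t => L (γ t - q)) 0 0 := by
    rw [hasDerivAt_iff_isLittleO]
    have := h2.trans_isBigO h3
    simpa [hγ0, Function.comp_def] using this
  have h5 : HasDerivAt (fun t => L (γ t - q)) (L v) 0 :=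
    L.hasFDerivAt.comp_hasDerivAt (0 : ℝ) (dγ.sub_const q)
  have h6 := h5.unique h4
  refine ⟨(‖w‖ ^ 2)⁻¹ * inner ℝ w v, ?_⟩
  have : v - (‖w‖ ^ 2)⁻¹ • (inner ℝ w v • w) = 0 := by simpa [L] using h6
  rw [mul_smul]
  exact sub_eq_zero.1 this

theorem HasDerivAt.nonpos_of_neg_right {φ : ℝ → ℝ} {m : ℝ} (h : HasDerivAt φ m 0) (h0 : φ 0 = 0)
    (hneg : ∀ᶠ t in 𝓝[>] (0 : ℝ), φ t < 0) : m ≤ 0 := by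
  refine le_of_tendsto h.tendsto_slope_zero_right ?_
  filter_upwards [hneg, self_mem_nhdsWithin] with t ht ht0
  simp only [zero_add, h0, sub_zero, smul_eq_mul]
  exact mul_nonpos_of_nonneg_of_nonpos (inv_nonneg.2 (le_of_lt ht0)) ht.le

section

variable {S : Set R3} {g : R3} {b : Module.Basis (Fin 3) ℝ R3} {f : ℝ × ℝ → ℝ} {V : Set R3}

theorem graphPt_zero (h0 : f 0 = 0) : graphPt b g f 0 = g := by
  simp [graphPt, h0]

theorem IsLocalEquation.fderiv_ne_zero {F : R3 → ℝ} {q v : R3} (hF : IsLocalEquation S q F)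
    (hq : q ∈ S) (hv : ¬ IsTangentVector S q v) : fderiv ℝ F q v ≠ 0 := by
  intro h
  refine hv ⟨F, hF, fun j hj => ?_⟩
  obtain ⟨U, hU, hqU, hFs, -, hSU⟩ := hF
  interval_cases j
  · have : q ∈ S ∩ U := ⟨hq, hqU⟩
    rw [hSU] at this
    simpa using this.2
  · rw [iteratedDeriv_one]
    have h1 : HasDerivAt (fun t : ℝ => q + t • v) v 0 := by
      have := ((hasDerivAt_id (0 : ℝ)).smul_const v).const_add q
      rwa [one_smul] at this
    have h2 : HasFDerivAt F (fderiv ℝ F q) (q + (0 : ℝ) • v) := by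
      rw [zero_smul, add_zero]
      exact ((hFs.contDiffAt (hU.mem_nhds hqU)).differentiableAt (by simp)).hasFDerivAt
    exact (HasFDerivAt.comp_hasDerivAt (f := fun t : ℝ => q + t • v) (0 : ℝ) h2 h1).deriv.trans h

/-- A smooth curve of `S` through a point of `V`, in coordinates. -/
theorem IsGraphOn.curve_coordinates (hG : IsGraphOn S g b f V) {p : ℝ × ℝ}
    (hp : graphPt b g f p ∈ V) {γ : ℝ → R3} {ε : ℝ} (hε : 0 < ε)
    (hγ : ContDiffOn ℝ ∞ γ (Ioo (-ε) ε)) (hγ0 : γ 0 = graphPt b g f p)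
    (hS : ∀ᶠ t in 𝓝 (0 : ℝ), γ t ∈ S) :
    ContDiffAt ℝ ∞ (fun t => crd b 0 (γ t - g)) 0 ∧ ContDiffAt ℝ ∞ (fun t => crd b 1 (γ t - g)) 0 ∧
    HasDerivAt (fun t => crd b 0 (γ t - g)) (crd b 0 (deriv γ 0)) 0 ∧
    HasDerivAt (fun t => crd b 1 (γ t - g)) (crd b 1 (deriv γ 0)) 0 ∧
    ∀ᶠ t in 𝓝 (0 : ℝ), γ t ∈ V ∧
      γ t = graphPt b g f (crd b 0 (γ t - g), crd b 1 (γ t - g)) := by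
  have hnh : Ioo (-ε) ε ∈ 𝓝 (0 : ℝ) := Ioo_mem_nhds (by linarith) hε
  have cγ := hγ.contDiffAt hnh
  have dγ : HasDerivAt γ (deriv γ 0) 0 := (cγ.differentiableAt (by simp)).hasDerivAt
  refine ⟨by fun_prop, by fun_prop, (crd b 0).hasFDerivAt.comp_hasDerivAt (0 : ℝ) (dγ.sub_const g),
    (crd b 1).hasFDerivAt.comp_hasDerivAt (0 : ℝ) (dγ.sub_const g), ?_⟩
  have hγV : ∀ᶠ t in 𝓝 (0 : ℝ), γ t ∈ V :=
    dγ.continuousAt.eventually (by rw [hγ0]; exact hG.isOpen.mem_nhds hp)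
  filter_upwards [hS, hγV] with t h1 h2
  exact ⟨h2, hG.curve_eq h2 h1⟩

/-- A tangent vector directed to the hyperbolic domain does not increase the Hessian. -/
theorem IsGraphOn.hess_deriv_nonpos (hG : IsGraphOn S g b f V) {p : ℝ × ℝ}
    (hp : graphPt b g f p ∈ V) (hyy : py (py f) p ≠ 0) (hh : hess f p = 0) {v : R3}
    (hv : IsDirectedTo S (hyperbolicDomain S) (graphPt b g f p) v) :
    px (hess f) p * crd b 0 v + py (hess f) p * crd b 1 v ≤ 0 := by
  have hf := hG.smooth
  obtain ⟨-, γ, ε, hε, hγ, hγ0, rfl, hS, hH⟩ := hv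
  have hnh : Ioo (-ε) ε ∈ 𝓝 (0 : ℝ) := Ioo_mem_nhds (by linarith) hε
  obtain ⟨-, -, dX, dY, hev⟩ := hG.curve_coordinates hp hε hγ hγ0 (eventually_of_mem hnh hS)
  have e0 : (crd b 0 (γ 0 - g), crd b 1 (γ 0 - g)) = p := by simp [hγ0]
  have dh := HasDerivAt.comp_partials (contDiff_hess hf) dX dY
  simp only [e0] at dh
  refine dh.nonpos_of_neg_right (by rw [e0, hh]) ?_
  have hyy' : ∀ᶠ t in 𝓝 (0 : ℝ), py (py f) (crd b 0 (γ t - g), crd b 1 (γ t - g)) ≠ 0 := by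
    have hc : ContinuousAt (fun t => py (py f) (crd b 0 (γ t - g), crd b 1 (γ t - g))) 0 :=
      ContinuousAt.comp (f := fun t => (crd b 0 (γ t - g), crd b 1 (γ t - g)))
        hf.py.py.continuous.continuousAt (dX.continuousAt.prodMk dY.continuousAt)
    exact hc.eventually_ne (by simpa only [e0] using hyy)
  filter_upwards [nhdsWithin_le_nhds hev, nhdsWithin_le_nhds hyy', Ioo_mem_nhdsGT hε]
    with t ht1 ht2 ht3
  have h4 := hH t ht3
  rw [ht1.2] at h4
  exact (hG.hyperbolic_iff (by rw [← ht1.2]; exact ht1.1) ht2).1 h4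

/-- The parabolic curve, in coordinates. -/
theorem IsGraphOn.parabolic_arc (hG : IsGraphOn S g b f V) (h0 : f 0 = 0)
    (hyy : py (py f) 0 ≠ 0) (hx : IsArcTangent (parabolicCurve S) g (b 0)) :
    ∃ X Y : ℝ → ℝ, ContDiffAt ℝ ∞ X 0 ∧ ContDiffAt ℝ ∞ Y 0 ∧ X 0 = 0 ∧ Y 0 = 0 ∧
      HasDerivAt X 1 0 ∧ HasDerivAt Y 0 0 ∧
      Filter.map (fun t => graphPt b g f (X t, Y t)) (𝓝 0) = 𝓝[parabolicCurve S] g ∧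
      ∀ᶠ t in 𝓝 (0 : ℝ), graphPt b g f (X t, Y t) ∈ V ∧ hess f (X t, Y t) = 0 := by
  obtain ⟨γ, ε, hε, hγ, hγ0, hv, -, hm⟩ := hx
  have hp : graphPt b g f 0 ∈ V := by rw [graphPt_zero h0]; exact hG.mem
  have hP : ∀ᶠ t in 𝓝 (0 : ℝ), γ t ∈ parabolicCurve S := by
    have : ∀ᶠ q in Filter.map γ (𝓝 0), q ∈ parabolicCurve S := by
      rw [hm]
      exact self_mem_nhdsWithin
    exact this
  obtain ⟨cX, cY, dX, dY, hev⟩ := hG.curve_coordinates hp hε hγ (by rw [hγ0, graphPt_zero h0])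
    (hP.mono fun t ht => ht.1)
  rw [hv] at dX dY
  have e0 : (crd b 0 (γ 0 - g), crd b 1 (γ 0 - g)) = (0, 0) := by simp [hγ0]
  have hyy' : ∀ᶠ t in 𝓝 (0 : ℝ), py (py f) (crd b 0 (γ t - g), crd b 1 (γ t - g)) ≠ 0 := by
    have hc : ContinuousAt (fun t => py (py f) (crd b 0 (γ t - g), crd b 1 (γ t - g))) 0 :=
      ContinuousAt.comp (f := fun t => (crd b 0 (γ t - g), crd b 1 (γ t - g)))
        hG.smooth.py.py.continuous.continuousAt (dX.continuousAt.prodMk dY.continuousAt)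
    exact hc.eventually_ne (by simp only [e0]; exact hyy)
  refine ⟨_, _, cX, cY, by simp [hγ0], by simp [hγ0], by simpa using dX, by simpa using dY, ?_, ?_⟩
  · rw [← hm]
    exact Filter.map_congr (hev.mono fun t ht => ht.2.symm)
  · filter_upwards [hev, hyy', hP] with t h1 h2 h3
    rw [h1.2] at h3
    have h4 : graphPt b g f (crd b 0 (γ t - g), crd b 1 (γ t - g)) ∈ V := by
      rw [← h1.2]
      exact h1.1
    exact ⟨h4, hG.hess_eq_zero_of_parabolic h4 h2 h3⟩

theorem IsGraphOn.py_py_nonneg_of_positiveSide (hG : IsGraphOn S g b f V) {p : ℝ × ℝ}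
    (hp : graphPt b g f p ∈ V) (h : IsPositiveSide S (graphPt b g f p) (b 2)) :
    0 ≤ py (py f) p := by
  have hf := hG.smooth
  have hcurve : Continuous fun t : ℝ => graphPt b g f (p.1 + t * 0, p.2 + t * 1) :=
    (ContDiff.graphPt hf).continuous.comp (by fun_prop)
  have htend : Tendsto (fun t : ℝ => graphPt b g f (p.1 + t * 0, p.2 + t * 1)) (𝓝 0)
      (𝓝[S] (graphPt b g f p)) := by
    have h1 : Tendsto (fun t : ℝ => graphPt b g f (p.1 + t * 0, p.2 + t * 1)) (𝓝 0)
        (𝓝 (graphPt b g f p)) := by simpa using hcurve.tendsto 0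
    refine tendsto_nhdsWithin_iff.2 ⟨h1, ?_⟩
    filter_upwards [h1.eventually (hG.isOpen.mem_nhds hp)] with t ht
    exact hG.graphPt_mem_iff ht
  -- Over a line parallel to the y-axis, the height of the graph above its tangent plane at `p` is
  -- the nonnegative coefficient `s`, and it vanishes at the point of tangency.
  have hmin : IsLocalMin (fun t => -graphLine b f p (graphVec b f p 0 1) t) 0 := by
    filter_upwards [htend.eventually h.2] with t ht
    obtain ⟨w, s, hw, hs, e⟩ := ht
    rw [hG.isTangentVector_iff hp] at hw
    have e' : graphPt b g f (p.1 + t * 0, p.2 + t * 1) - g -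
        (graphPt b g f p - g) = w + s • b 2 := by rw [← e]; abel
    have e0 := congrArg (crd b 0) e'
    have e1 := congrArg (crd b 1) e'
    have e2 := congrArg (crd b 2) e'
    rw [map_sub] at e0 e1 e2
    simp only [crd_zero_graphPt, crd_one_graphPt, crd_two_graphPt, map_add, map_smul,
      crd_basis] at e0 e1 e2
    simp at e0 e1 e2
    rw [hw, ← e0, ← e1] at e2
    simp [graphLine]
    linarith
  have h2 := hmin.deriv_deriv_nonneg (contDiff_graphLine hf p _).continuous.neg.continuousAt
  have h3 : deriv (fun t => -graphLine b f p (graphVec b f p 0 1) t) =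
      fun t => -deriv (graphLine b f p (graphVec b f p 0 1)) t := by
    ext t
    exact deriv.fun_neg
  rw [h3, deriv.fun_neg, deriv_deriv_graphLine hf] at h2
  simpa [quad] using h2

/-- Elliptic points with f_yy ≥ 0 accumulate at `g`; the sign passes to the limit by continuity.
This is where the direction of the z-axis fixes a sign. -/
theorem IsGraphOn.py_py_nonneg (hG : IsGraphOn S g b f V)
    (h : IsDirectedToPositiveHalfSpace S g (b 2)) : 0 ≤ py (py f) 0 := by
  by_contra! hneg
  have : (𝓝[ellipticDomain S] g).NeBot := mem_closure_iff_nhdsWithin_neBot.1 h.2.1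
  have hc : Continuous fun q : R3 => py (py f) (crd b 0 (q - g), crd b 1 (q - g)) :=
    hG.smooth.py.py.continuous.comp (by fun_prop)
  have h1 : ∀ᶠ q in 𝓝 g, py (py f) (crd b 0 (q - g), crd b 1 (q - g)) < 0 :=
    hc.continuousAt.eventually_lt continuousAt_const (by simp only [sub_self, map_zero]; exact hneg)
  obtain ⟨q, hq1, ⟨hq2, hqV⟩, hqE⟩ := (h.2.2.and ((Eventually.filter_mono nhdsWithin_le_nhds
    (h1.and (hG.isOpen.mem_nhds hG.mem))).and eventually_mem_nhdsWithin)).exists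
  have e := eq_graphPt ((hG.mem_iff q hqV).1 hqE.1)
  rw [e] at hq1 hqV
  exact absurd (hG.py_py_nonneg_of_positiveSide hqV hq1) (not_le.2 hq2)

end

/-! ### The A₃ condition, tested along a parabola -/

section parabola

variable {h : ℝ × ℝ → ℝ} (α : ℝ)

theorem deriv_comp_parabola (hh : ContDiff ℝ ∞ h) : deriv (fun t => h (t, α * t ^ 2)) =
    fun t => px h (t, α * t ^ 2) + 2 * α * t * py h (t, α * t ^ 2) := by
  ext t
  have h1 : HasDerivAt (fun t : ℝ => α * t ^ 2) (2 * α * t) t := by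
    exact ((hasDerivAt_pow 2 t).const_mul α).congr_deriv (by push_cast; ring)
  refine (HasDerivAt.comp_partials hh (hasDerivAt_id t) h1).deriv.trans ?_
  simp only [id]
  ring

theorem differentiable_comp_parabola (hh : ContDiff ℝ ∞ h) :
    Differentiable ℝ fun t => h (t, α * t ^ 2) :=
  ContDiff.differentiable (n := ∞) (by fun_prop) (by simp)

theorem contDiffAt_comp_parabola (hh : ContDiff ℝ ∞ h) (n : ℕ) :
    ContDiffAt ℝ n (fun t => h (t, α * t ^ 2)) 0 := by
  have : ContDiff ℝ ∞ fun t => h (t, α * t ^ 2) := by fun_prop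
  exact this.contDiffAt.of_le (by exact_mod_cast le_top)

theorem deriv_deriv_comp_parabola (hh : ContDiff ℝ ∞ h) :
    deriv (deriv (fun t => h (t, α * t ^ 2))) = fun t => px (px h) (t, α * t ^ 2) +
      4 * α * t * px (py h) (t, α * t ^ 2) + 4 * α ^ 2 * t ^ 2 * py (py h) (t, α * t ^ 2) +
      2 * α * py h (t, α * t ^ 2) := by
  rw [deriv_comp_parabola α hh]
  ext t
  have h1 := (differentiable_comp_parabola α hh.px t).hasDerivAt
  have h2 := (differentiable_comp_parabola α hh.py t).hasDerivAt
  rw [deriv_comp_parabola α hh.px] at h1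
  rw [deriv_comp_parabola α hh.py] at h2
  refine (h1.add (((hasDerivAt_id t).const_mul (2 * α)).mul h2)).deriv.trans ?_
  simp only [id, py_px hh]
  ring

theorem deriv_three_comp_parabola (hh : ContDiff ℝ ∞ h) :
    deriv (deriv (deriv (fun t => h (t, α * t ^ 2)))) 0 =
      px (px (px h)) 0 + 6 * α * px (py h) 0 := by
  rw [deriv_deriv_comp_parabola α hh]
  have h1 := (differentiable_comp_parabola α hh.px.px 0).hasDerivAt
  have h2 := (differentiable_comp_parabola α hh.py.px 0).hasDerivAt
  have h3 := (differentiable_comp_parabola α hh.py.py 0).hasDerivAt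
  have h4 := (differentiable_comp_parabola α hh.py 0).hasDerivAt
  rw [deriv_comp_parabola α hh.px.px] at h1
  rw [deriv_comp_parabola α hh.py] at h4
  have e1 := ((hasDerivAt_id (0 : ℝ)).const_mul (4 * α)).mul h2
  have e2 := (((hasDerivAt_id (0 : ℝ)).pow 2).const_mul (4 * α ^ 2)).mul h3
  refine (((h1.add e1).add e2).add (h4.const_mul (2 * α))).deriv.trans ?_
  simp [Prod.mk_zero_zero]
  ring

theorem isLittleO_comp_parabola (hh : ContDiff ℝ ∞ h) (h0 : h 0 = 0) (h1 : px h 0 = 0)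
    (h2 : px (px h) 0 + 2 * α * py h 0 = 0) :
    (fun t => h (t, α * t ^ 2)) =o[𝓝 0] fun t : ℝ => t ^ 2 := by
  have e : ((0 : ℝ), α * 0 ^ 2) = 0 := by ext <;> simp
  refine isLittleO_pow_of_iteratedDeriv_eq_zero (contDiffAt_comp_parabola α hh _) fun j hj => ?_
  interval_cases j
  · rw [iteratedDeriv_zero, e, h0]
  · rw [iteratedDeriv_one, deriv_comp_parabola α hh]
    simp only [e]
    linarith
  · rw [iteratedDeriv_succ, iteratedDeriv_one, deriv_deriv_comp_parabola α hh]
    simp only [e]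
    linarith

theorem isLittleO_cube_comp_parabola (hh : ContDiff ℝ ∞ h) (h0 : h 0 = 0) (h1 : px h 0 = 0)
    (h2 : px (px h) 0 + 2 * α * py h 0 = 0)
    (h3 : px (px (px h)) 0 + 6 * α * px (py h) 0 = 0) :
    (fun t => h (t, α * t ^ 2)) =o[𝓝 0] fun t : ℝ => t ^ 3 := by
  have e : ((0 : ℝ), α * 0 ^ 2) = 0 := by ext <;> simp
  refine isLittleO_pow_of_iteratedDeriv_eq_zero (contDiffAt_comp_parabola α hh _) fun j hj => ?_
  interval_cases j
  · rw [iteratedDeriv_zero, e, h0]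
  · rw [iteratedDeriv_one, deriv_comp_parabola α hh]
    simp only [e]
    linarith
  · rw [iteratedDeriv_succ, iteratedDeriv_one, deriv_deriv_comp_parabola α hh]
    simp only [e]
    linarith
  · rw [iteratedDeriv_succ, iteratedDeriv_succ, iteratedDeriv_one,
      deriv_three_comp_parabola α hh, h3]

end parabola

/-- A function equivalent to `u ^ 2 ± v ^ 4` satisfies the nondegeneracy condition of `A₃`. -/
theorem three_mul_sq_ne_of_equiv_A3 {f u v : ℝ × ℝ → ℝ} (hf : ContDiff ℝ ∞ f)
    (hu : ContDiff ℝ ∞ u) (hv : ContDiff ℝ ∞ v) (hf0 : f 0 = 0) (hx : px f 0 = 0)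
    (hy : py f 0 = 0) (hxx : px (px f) 0 = 0) (hxy : px (py f) 0 = 0) (hyy : py (py f) 0 ≠ 0)
    (hxxx : px (px (px f)) 0 = 0) (hu0 : u 0 = 0) (hv0 : v 0 = 0)
    (hinj : ∀ a c, px u 0 * a + py u 0 * c = 0 → px v 0 * a + py v 0 * c = 0 → a = 0 ∧ c = 0)
    {l₀ l₁ l₂ δ : ℝ} (hδ : δ = 1 ∨ δ = -1)
    (hid : ∀ᶠ p in 𝓝 (0 : ℝ × ℝ),
      p.1 * l₀ + p.2 * l₁ + f p * l₂ = u p ^ 2 + δ * v p ^ 4) :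
    3 * px (px (py f)) 0 ^ 2 ≠ py (py f) 0 * px (px (px (px f))) 0 := by
  intro hB
  -- the gradients of both sides
  have hgrad : ∀ᶠ p in 𝓝 (0 : ℝ × ℝ), ∀ a c : ℝ,
      a * l₀ + c * l₁ + (px f p * a + py f p * c) * l₂ =
        2 * u p * (px u p * a + py u p * c) +
          4 * δ * v p ^ 3 * (px v p * a + py v p * c) := by
    filter_upwards [hid.eventually_nhds] with p hp a c
    have hline : Tendsto (fun t : ℝ => (p.1 + t * a, p.2 + t * c)) (𝓝 0) (𝓝 p) := by
      have : Continuous fun t : ℝ => (p.1 + t * a, p.2 + t * c) := by fun_prop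
      simpa using this.tendsto 0
    have e := hline.eventually hp
    have hX : HasDerivAt (fun t : ℝ => p.1 + t * a) a 0 := by
      simpa using ((hasDerivAt_id (0 : ℝ)).mul_const a).const_add p.1
    have hY : HasDerivAt (fun t : ℝ => p.2 + t * c) c 0 := by
      simpa using ((hasDerivAt_id (0 : ℝ)).mul_const c).const_add p.2
    have d1 := ((hX.mul_const l₀).add (hY.mul_const l₁)).add
      ((hasDerivAt_line hf p a c 0).mul_const l₂)
    have d2 := ((hasDerivAt_line hu p a c 0).pow 2).add
      (((hasDerivAt_line hv p a c 0).pow 4).const_mul δ)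
    have := (d2.congr_of_eventuallyEq e).unique d1
    simp at this
    rw [← this]
    ring
  -- At the origin the gradients of `f` and of the right-hand side vanish, so the linear terms are
  -- absent from the identity.
  have hl : ∀ a c : ℝ, a * l₀ + c * l₁ = 0 := fun a c => by
    have := hgrad.self_of_nhds a c
    simpa [hx, hy, hu0, hv0] using this
  have hJ : px u 0 * py v 0 - py u 0 * px v 0 ≠ 0 := by
    intro hJ
    obtain ⟨h1, h2⟩ := hinj (py v 0) (-px v 0) (by linarith) (by ring)
    obtain ⟨h3, h4⟩ := hinj (py u 0) (-px u 0) (by ring) (by linarith)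
    have := hinj 1 0 (by rw [h3, neg_eq_zero.1 h4]; ring) (by rw [h1, neg_eq_zero.1 h2]; ring)
    exact one_ne_zero this.1
  -- This α cancels the t² term of f_y along the parabola; the t³ term of f_x then has coefficient
  -- proportional to f_xxxx - 3 f_xxy² / f_yy, which is 0 by `hB`.
  set α := -px (px (py f)) 0 / (2 * py (py f) 0) with hα
  have e : ((0 : ℝ), α * 0 ^ 2) = 0 := by ext <;> simp
  have hpx : (fun t => px f (t, α * t ^ 2)) =o[𝓝 0] fun t : ℝ => t ^ 3 := by
    refine isLittleO_cube_comp_parabola α hf.px hx hxx ?_ ?_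
    · rw [py_px hf, hxxx, hxy]
      ring
    · rw [py_px hf, hα]
      field_simp
      linarith
  have hpy : (fun t => py f (t, α * t ^ 2)) =o[𝓝 0] fun t : ℝ => t ^ 2 := by
    refine isLittleO_comp_parabola α hf.py hy hxy ?_
    rw [hα]
    field_simp
    ring
  have hf4 : (fun t => f (t, α * t ^ 2)) =o[𝓝 0] fun t : ℝ => t ^ 4 := by
    have hd : (fun t => px f (t, α * t ^ 2) + 2 * α * t * py f (t, α * t ^ 2)) =o[𝓝 0]
        fun t : ℝ => t ^ 3 := by
      refine hpx.add ?_
      have h1 : (fun t : ℝ => 2 * α * t) =O[𝓝 0] fun t : ℝ => t :=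
        Asymptotics.isBigO_const_mul_self _ _ _
      exact (h1.mul_isLittleO hpy).congr_right fun t => by ring
    have := Convex.isLittleO_pow_succ_real (s := univ) convex_univ (mem_univ (0 : ℝ)) (n := 3)
      (f := fun t => f (t, α * t ^ 2))
      (f' := fun t => px f (t, α * t ^ 2) + 2 * α * t * py f (t, α * t ^ 2))
      (fun t _ => by
        have := (differentiable_comp_parabola α hf t).hasDerivAt
        rw [deriv_comp_parabola α hf] at this
        exact this.hasDerivWithinAt) (by simpa using hd)
    simpa [Prod.mk_zero_zero, hf0] using this
  have hc : Tendsto (fun t : ℝ => (t, α * t ^ 2)) (𝓝 0) (𝓝 0) := by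
    have : Continuous fun t : ℝ => (t, α * t ^ 2) := by fun_prop
    have := this.tendsto 0
    rwa [e] at this
  have hbdd : ∀ k : ℝ × ℝ → ℝ, ContDiff ℝ ∞ k → (fun t : ℝ => k (t, α * t ^ 2)) =O[𝓝 0]
      fun _ : ℝ => (1 : ℝ) := fun k hk => (hk.continuous.tendsto 0).comp hc |>.isBigO_one ℝ
  -- the second order smallness of `u`
  have hu2 : (fun t => u (t, α * t ^ 2)) =o[𝓝 0] fun t : ℝ => t ^ 2 := by
    have hpx2 : (fun t => px f (t, α * t ^ 2)) =o[𝓝 0] fun t : ℝ => t ^ 2 :=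
      hpx.trans (Asymptotics.isLittleO_pow_pow (by norm_num))
    have h1 : (fun t => l₂ * (py v (t, α * t ^ 2) * px f (t, α * t ^ 2) -
        px v (t, α * t ^ 2) * py f (t, α * t ^ 2))) =o[𝓝 0] fun t : ℝ => t ^ 2 := by
      have a1 := ((hbdd _ hv.py).mul_isLittleO hpx2).sub ((hbdd _ hv.px).mul_isLittleO hpy)
      exact (a1.const_mul_left l₂).congr_right fun t => by ring
    -- The gradient identity is evaluated on the vector (v_y, -v_x), which dv annihilates: only u
    -- times the Jacobian remains, and the Jacobian is not 0.
    have h2 : (fun t => u (t, α * t ^ 2) * (2 * (px u (t, α * t ^ 2) * py v (t, α * t ^ 2) -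
        py u (t, α * t ^ 2) * px v (t, α * t ^ 2)))) =o[𝓝 0] fun t : ℝ => t ^ 2 := by
      refine h1.congr' ?_ EventuallyEq.rfl
      filter_upwards [hc.eventually hgrad] with t ht
      have := ht (py v (t, α * t ^ 2)) (-px v (t, α * t ^ 2))
      rw [hl] at this
      linear_combination this
    have h3 : (fun t : ℝ => (2 * (px u (t, α * t ^ 2) * py v (t, α * t ^ 2) -
        py u (t, α * t ^ 2) * px v (t, α * t ^ 2)))⁻¹) =O[𝓝 0] fun _ : ℝ => (1 : ℝ) := by
      have hcj : Continuous fun p => 2 * (px u p * py v p - py u p * px v p) := by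
        have := hu.px.continuous
        have := hu.py.continuous
        have := hv.px.continuous
        have := hv.py.continuous
        fun_prop
      exact (((hcj.tendsto 0).comp hc).inv₀ (mul_ne_zero two_ne_zero hJ)).isBigO_one ℝ
    have hne : ∀ᶠ t : ℝ in 𝓝 0, 2 * (px u (t, α * t ^ 2) * py v (t, α * t ^ 2) -
        py u (t, α * t ^ 2) * px v (t, α * t ^ 2)) ≠ 0 := by
      have hcj : Continuous fun p => 2 * (px u p * py v p - py u p * px v p) := by
        have := hu.px.continuous
        have := hu.py.continuous
        have := hv.px.continuous
        have := hv.py.continuous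
        fun_prop
      exact ((hcj.tendsto 0).comp hc).eventually_ne (mul_ne_zero two_ne_zero hJ)
    refine (h2.mul_isBigO h3).congr' ?_ (Eventually.of_forall fun t => by simp)
    filter_upwards [hne] with t ht
    rw [mul_assoc, mul_inv_cancel₀ ht, mul_one]
  -- Since δ² = 1, v⁴ = δ (l₂ f - u²), and both terms are o(t⁴).
  have hv1 : (fun t => v (t, α * t ^ 2)) =o[𝓝 0] fun t : ℝ => t := by
    refine Asymptotics.IsLittleO.of_pow (n := 4) ?_ (by norm_num)
    have h1 : (fun t => u (t, α * t ^ 2) ^ 2) =o[𝓝 0] fun t : ℝ => t ^ 4 :=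
      (hu2.pow (n := 2) (by norm_num)).congr_right fun t => by ring
    refine (((hf4.const_mul_left l₂).sub h1).const_mul_left δ).congr' ?_ EventuallyEq.rfl
    filter_upwards [hc.eventually hid] with t ht
    simp only [hl, zero_add] at ht
    have hδ2 : δ * δ = 1 := by rcases hδ with rfl | rfl <;> norm_num
    simp only [Pi.pow_apply]
    linear_combination δ * ht + v (t, α * t ^ 2) ^ 4 * hδ2
  -- The parabola has velocity (1, 0) at 0. So du and dv would both vanish on this vector, against
  -- their independence.
  have hder : ∀ k : ℝ × ℝ → ℝ, ContDiff ℝ ∞ k → k 0 = 0 →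
      (fun t => k (t, α * t ^ 2)) =o[𝓝 0] (fun t : ℝ => t) → px k 0 = 0 := by
    intro k hk hk0 ho
    have d1 := (differentiable_comp_parabola α hk 0).hasDerivAt
    rw [deriv_comp_parabola α hk] at d1
    have d2 : HasDerivAt (fun t => k (t, α * t ^ 2)) 0 0 := by
      rw [hasDerivAt_iff_isLittleO]
      simpa [Prod.mk_zero_zero, hk0] using ho
    have := d1.unique d2
    simpa [Prod.mk_zero_zero] using this
  have hu1 := hder u hu hu0 (hu2.trans_isBigO (by
    have : (fun t : ℝ => t ^ 2) =O[𝓝 0] fun t : ℝ => t ^ 1 :=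
      (Asymptotics.isLittleO_pow_pow (by norm_num : 1 < 2)).isBigO
    simpa using this))
  have hv1' := hder v hv hv0 hv1
  exact hJ (by rw [hu1, hv1']; ring)

section

variable {S : Set R3} {g : R3} {b : Module.Basis (Fin 3) ℝ R3} {f : ℝ × ℝ → ℝ} {V : Set R3}

/-- The projection to the (x, y)-plane of the given parametrisation is a local diffeomorphism. Its
inverse, obtained by solving q(w) - p = 0 for w, has as components the functions u, v of
`three_mul_sq_ne_of_equiv_A3`. -/
theorem HasA3Contact.three_mul_sq_ne (hA : HasA3Contact S g) (hG : IsGraphOn S g b f V)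
    (hf0 : f 0 = 0) (hx : px f 0 = 0)
    (hy : py f 0 = 0) (hxx : px (px f) 0 = 0) (hxy : px (py f) 0 = 0) (hyy : py (py f) 0 ≠ 0)
    (hxxx : px (px (px f)) 0 = 0) :
    3 * px (px (py f)) 0 ^ 2 ≠ py (py f) 0 * px (px (px (px f))) 0 := by
  obtain ⟨φ, W, l, δ, hW, h0W, hφ, hφ0, hinj, hδ, hφS⟩ := hA
  have hf := hG.smooth
  let q : ℝ × ℝ → ℝ × ℝ := fun w => (crd b 0 (φ w - g), crd b 1 (φ w - g))
  have hq : ContDiffOn ℝ ∞ q W := by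
    have : ContDiffOn ℝ ∞ (fun w => φ w - g) W := hφ.sub contDiffOn_const
    exact ((crd b 0).contDiff.comp_contDiffOn this).prodMk ((crd b 1).contDiff.comp_contDiffOn this)
  have hq0 : q 0 = 0 := by simp [q, hφ0]
  have hφV : ∀ᶠ w in 𝓝 (0 : ℝ × ℝ), φ w ∈ V ∧ w ∈ W :=
    ((hφ.continuousOn.continuousAt (hW.mem_nhds h0W)).eventually
      (by rw [hφ0]; exact hG.isOpen.mem_nhds hG.mem)).and (hW.mem_nhds h0W)
  have hφq : ∀ᶠ w in 𝓝 (0 : ℝ × ℝ), φ w = graphPt b g f (q w) := by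
    filter_upwards [hφV] with w hw
    exact eq_graphPt ((hG.mem_iff _ hw.1).1 (hφS w hw.2).1)
  have dq : HasFDerivAt q (fderiv ℝ q 0) 0 :=
    ((hq.contDiffAt (hW.mem_nhds h0W)).differentiableAt (by simp)).hasFDerivAt
  have hqinj : Function.Injective (fderiv ℝ q 0) := by
    have d1 : HasFDerivAt (graphPt b g f) (fderiv ℝ (graphPt b g f) 0) (q 0) := by
      rw [hq0]
      exact ((ContDiff.graphPt hf).differentiable (by simp) 0).hasFDerivAt
    have d2 := (d1.comp (0 : ℝ × ℝ) dq).congr_of_eventuallyEq hφq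
    rw [d2.fderiv] at hinj
    exact Function.Injective.of_comp (f := fderiv ℝ (graphPt b g f) 0) hinj
  let e : (ℝ × ℝ) ≃L[ℝ] (ℝ × ℝ) :=
    (LinearEquiv.ofInjectiveEndo (fderiv ℝ q 0 : (ℝ × ℝ) →ₗ[ℝ] (ℝ × ℝ)) hqinj).toContinuousLinearEquiv
  have he : (e : (ℝ × ℝ) →L[ℝ] (ℝ × ℝ)) = fderiv ℝ q 0 := by
    ext <;> rfl
  have hinv : (fderiv ℝ (fun x : (ℝ × ℝ) × (ℝ × ℝ) => q x.2 - x.1) 0 ∘L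
      .inr ℝ (ℝ × ℝ) (ℝ × ℝ)).IsInvertible := by
    refine ⟨e, ?_⟩
    rw [he]
    have d1 : HasFDerivAt (fun x : (ℝ × ℝ) × (ℝ × ℝ) => q x.2 - x.1)
        (fderiv ℝ q 0 ∘L .snd ℝ (ℝ × ℝ) (ℝ × ℝ) - .fst ℝ (ℝ × ℝ) (ℝ × ℝ)) 0 :=
      (HasFDerivAt.comp (0 : (ℝ × ℝ) × (ℝ × ℝ)) (g := q) dq hasFDerivAt_snd).sub hasFDerivAt_fst
    rw [d1.fderiv]
    ext <;> simp
  obtain ⟨ψ, W', hW', h0W', hψ, hψ0, hψiff⟩ := exists_contDiffOn_implicitFunction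
    (hW.preimage continuous_snd) (u := (0 : (ℝ × ℝ) × (ℝ × ℝ))) h0W
    (G := fun x : (ℝ × ℝ) × (ℝ × ℝ) => q x.2 - x.1)
    ((hq.comp contDiffOn_snd fun _ h => h).sub contDiffOn_fst) hinv
  obtain ⟨ψ', hψ's, hψ'⟩ := exists_contDiff_eventuallyEq hW' h0W' hψ
  have hψ'0 : ψ' 0 = 0 := hψ'.self_of_nhds.trans hψ0
  have hψ't : Tendsto ψ' (𝓝 0) (𝓝 0) := by
    have := hψ's.continuous.tendsto 0
    rwa [hψ'0] at this
  have hqψ : ∀ᶠ p in 𝓝 (0 : ℝ × ℝ), q (ψ' p) = p := by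
    have ht : Tendsto (fun p => (p, ψ' p)) (𝓝 0) (𝓝 (0 : (ℝ × ℝ) × (ℝ × ℝ))) :=
      tendsto_id.prodMk_nhds hψ't
    filter_upwards [ht.eventually hψiff, hψ'] with p h1 h2
    have h3 := h1.2 h2.symm
    have h4 : q ((0 : (ℝ × ℝ) × (ℝ × ℝ)).2) - (0 : (ℝ × ℝ) × (ℝ × ℝ)).1 = 0 := by
      simp [hq0]
    rw [h4] at h3
    exact sub_eq_zero.1 h3
  refine three_mul_sq_ne_of_equiv_A3 (u := fun p => (ψ' p).1) (v := fun p => (ψ' p).2) hf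
    (by fun_prop) (by fun_prop) hf0 hx hy hxx hxy hyy hxxx (by simp [hψ'0]) (by simp [hψ'0]) ?_
    (l₀ := l (b 0)) (l₁ := l (b 1)) (l₂ := l (b 2)) hδ ?_
  · intro a c hu hv
    have dψ : HasFDerivAt ψ' (fderiv ℝ ψ' 0) 0 := (hψ's.differentiable (by simp) 0).hasFDerivAt
    have du : fderiv ℝ (fun p => (ψ' p).1) 0 = .fst ℝ ℝ ℝ ∘L fderiv ℝ ψ' 0 :=
      (hasFDerivAt_fst.comp (0 : ℝ × ℝ) dψ).fderiv
    have dv : fderiv ℝ (fun p => (ψ' p).2) 0 = .snd ℝ ℝ ℝ ∘L fderiv ℝ ψ' 0 :=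
      (hasFDerivAt_snd.comp (0 : ℝ × ℝ) dψ).fderiv
    have hu' := fderiv_eq_partials (fun p => (ψ' p).1) 0 (a, c)
    have hv' := fderiv_eq_partials (fun p => (ψ' p).2) 0 (a, c)
    rw [hu, du] at hu'
    rw [hv, dv] at hv'
    have hz : fderiv ℝ ψ' 0 (a, c) = 0 := Prod.ext hu' hv'
    have dq' : HasFDerivAt q (fderiv ℝ q 0) (ψ' 0) := by rw [hψ'0]; exact dq
    have h1 : HasFDerivAt (fun p : ℝ × ℝ => p) (fderiv ℝ q 0 ∘L fderiv ℝ ψ' 0) 0 :=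
      (dq'.comp (0 : ℝ × ℝ) dψ).congr_of_eventuallyEq (hqψ.mono fun p hp => hp.symm)
    have h2 := h1.unique (hasFDerivAt_id (0 : ℝ × ℝ))
    have h3 := congrArg (fun L : (ℝ × ℝ) →L[ℝ] (ℝ × ℝ) => L (a, c)) h2
    simp only [ContinuousLinearMap.comp_apply, hz, map_zero, ContinuousLinearMap.id_apply] at h3
    exact ⟨(congrArg Prod.fst h3).symm, (congrArg Prod.snd h3).symm⟩
  · filter_upwards [hqψ, hψ't.eventually hφq, hψ't.eventually hφV] with p h1 h2 h3
    have h4 := (hφS _ h3.2).2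
    rw [h2, h1] at h4
    rw [← h4]
    simp [graphPt]

end

/-! ### The jet of a simple godron and its index -/

/-- The jet conditions satisfied by `f`, when its graph has a simple godron at the origin, in
adapted coordinates. -/
structure IsGodronJet (f : ℝ × ℝ → ℝ) : Prop where
  zero : f 0 = 0
  x : px f 0 = 0
  y : py f 0 = 0
  xx : px (px f) 0 = 0
  xy : px (py f) 0 = 0
  yy : 0 < py (py f) 0
  xxx : px (px (px f)) 0 = 0
  xxy : px (px (py f)) 0 < 0
  ne : 3 * px (px (py f)) 0 ^ 2 ≠ py (py f) 0 * px (px (px (px f))) 0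

/-- The number whose sign is the index of the godron. -/
noncomputable def godronSign (f : ℝ × ℝ → ℝ) : ℝ :=
  py (py f) 0 * px (px (px (px f))) 0 - 3 * px (px (py f)) 0 ^ 2

theorem IsGodronJet.godronSign_ne_zero {f : ℝ × ℝ → ℝ} (hJ : IsGodronJet f) :
    godronSign f ≠ 0 := sub_ne_zero.2 hJ.ne.symm

/-- A function with a simple zero changes sign. -/
theorem HasDerivAt.eventually_sign {φ : ℝ → ℝ} {D : ℝ} (h : HasDerivAt φ D 0) (h0 : φ 0 = 0)
    (hD : D ≠ 0) : ∀ᶠ t in 𝓝 (0 : ℝ), (0 < φ t ↔ 0 < D * t) ∧ (φ t < 0 ↔ D * t < 0) := by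
  have h1 := (h.isLittleO).def (half_pos (abs_pos.2 hD))
  filter_upwards [h1] with t ht
  simp only [h0, sub_zero, smul_eq_mul, Real.norm_eq_abs] at ht
  have h2 : |D| / 2 * |t| = |D * t| / 2 := by rw [abs_mul]; ring
  rw [h2, mul_comm t D, abs_le] at ht
  rcases lt_trichotomy (D * t) 0 with h3 | h3 | h3
  · rw [abs_of_neg h3] at ht
    constructor <;> constructor <;> intro <;> linarith
  · rw [h3, abs_zero] at ht
    constructor <;> constructor <;> intro <;> linarith
  · rw [abs_of_pos h3] at ht
    constructor <;> constructor <;> intro <;> linarith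

section

variable {S : Set R3} {g : R3} {b : Module.Basis (Fin 3) ℝ R3} {f : ℝ × ℝ → ℝ} {V : Set R3}

theorem exists_isGodronJet {o : Orientation ℝ R3 (Fin 3)} (hS : IsSmoothSurface S)
    (hg : IsSimpleGodron S g) (hb : IsAdaptedFrame o S g b) :
    ∃ f V, IsGraphOn S g b f V ∧ IsGodronJet f := by
  obtain ⟨⟨hpar, v, hva, hvarc⟩, hA⟩ := hg
  have hgS : g ∈ S := hpar.1
  obtain ⟨F, hF⟩ := hS g hgS
  obtain ⟨f, V, hG, h0⟩ := hF.exists_isGraphOn hgS b (hF.fderiv_ne_zero hgS hb.z_positive.1)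
  have hf := hG.smooth
  have hg0 : graphPt b g f 0 = g := graphPt_zero h0
  have hp : graphPt b g f 0 ∈ V := by rw [hg0]; exact hG.mem
  have hx : px f 0 = 0 := by
    have := (hG.isTangentVector_iff hp (b 0)).1 (by rw [hg0]; exact hb.x_tangent)
    simpa using this.symm
  have hy : py f 0 = 0 := by
    have := (hG.isTangentVector_iff hp (b 1)).1 (by rw [hg0]; exact hb.y_tangent)
    simpa using this.symm
  have hxx : px (px f) 0 = 0 := by
    obtain ⟨μ, rfl⟩ := hvarc.exists_smul_eq hb.x_parabolic
    have hμ : μ ≠ 0 := by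
      rintro rfl
      obtain ⟨-, -, -, -, -, -, h, -⟩ := hvarc
      simp at h
    have := ((hG.isAsymptoticVector_iff hp (μ • b 0)).1 (by rw [hg0]; exact hva)).2
    simpa [quad, hμ] using this
  -- Otherwise both the x- and y-axes would be asymptotic at a parabolic point.
  have hyy0 : py (py f) 0 ≠ 0 := by
    intro hyy
    obtain ⟨-, v₁, hv₁, hiff⟩ := hpar
    have h1 : b 0 ∈ Submodule.span ℝ {v₁} := by
      rw [← hiff, ← hg0, hG.isAsymptoticVector_iff hp]
      simp [quad, hx, hxx]
    have h2 : b 1 ∈ Submodule.span ℝ {v₁} := by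
      rw [← hiff, ← hg0, hG.isAsymptoticVector_iff hp]
      simp [quad, hy, hyy]
    obtain ⟨s, hs⟩ := Submodule.mem_span_singleton.1 h1
    obtain ⟨t, ht⟩ := Submodule.mem_span_singleton.1 h2
    have e1 := congrArg (crd b 0) hs
    have e2 := congrArg (crd b 1) hs
    have e3 := congrArg (crd b 0) ht
    have e4 := congrArg (crd b 1) ht
    simp at e1 e2 e3 e4
    rcases e2 with e2 | e2
    · simp [e2] at e1
    · simp [e2] at e4
  have hyy : 0 < py (py f) 0 := lt_of_le_of_ne (hG.py_py_nonneg hb.z_positive) hyy0.symm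
  have hh0 : hess f 0 = 0 := hG.hess_eq_zero_of_parabolic hp hyy0 (by rw [hg0]; exact hpar)
  have hxy : px (py f) 0 = 0 := by
    rw [hess, hxx] at hh0
    simpa using hh0
  obtain ⟨X, Y, cX, cY, hX0, hY0, dX, dY, -, hev⟩ := hG.parabolic_arc h0 hyy0 hb.x_parabolic
  have hX1 : ∀ᶠ t in 𝓝 (0 : ℝ), HasDerivAt X (deriv X t) t :=
    ((cX.of_le (m := 1) (by simp)).eventually (by simp)).mono fun t ht =>
      (ht.differentiableAt (by simp)).hasDerivAt
  have hY1 : ∀ᶠ t in 𝓝 (0 : ℝ), HasDerivAt Y (deriv Y t) t :=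
    ((cY.of_le (m := 1) (by simp)).eventually (by simp)).mono fun t ht =>
      (ht.differentiableAt (by simp)).hasDerivAt
  -- the derivative of the Hessian along the parabolic curve
  have hder : (fun t => px (hess f) (X t, Y t) * deriv X t + py (hess f) (X t, Y t) * deriv Y t)
      =ᶠ[𝓝 0] fun _ => 0 := by
    filter_upwards [hX1, hY1, hev.eventually_nhds] with t h1 h2 h3
    have e1 := HasDerivAt.comp_partials (contDiff_hess hf) h1 h2
    have e2 : (fun s => hess f (X s, Y s)) =ᶠ[𝓝 t] fun _ => 0 := h3.mono fun s hs => hs.2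
    exact e1.unique ((hasDerivAt_const t (0 : ℝ)).congr_of_eventuallyEq e2)
  -- At 0 the arc has velocity e_x, and the x-derivative of the Hessian there is f_xxx f_yy.
  have hxxx : px (px (px f)) 0 = 0 := by
    have := hder.self_of_nhds
    simp only [hX0, hY0, dX.deriv, dY.deriv, mul_one, mul_zero, add_zero, Prod.mk_zero_zero,
      px_hess hf, hxx, hxy, zero_mul, sub_zero] at this
    exact (mul_eq_zero.1 this).resolve_right hyy0
  have hne := hA.three_mul_sq_ne hG h0 hx hy hxx hxy hyy0 hxxx
  have hpyh : py (hess f) 0 = px (px (py f)) 0 * py (py f) 0 := by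
    simp [py_hess hf, hxx, hxy]
  have hpxh : px (hess f) 0 = 0 := by
    simp [px_hess hf, hxx, hxy, hxxx]
  -- The y-axis enters the hyperbolic domain, so the y-derivative f_xxy f_yy of the Hessian is not
  -- positive.
  have hle : px (px (py f)) 0 ≤ 0 := by
    have := hG.hess_deriv_nonpos hp hyy0 hh0 (by rw [hg0]; exact hb.y_hyperbolic)
    simp only [crd_basis, hpxh, hpyh] at this
    simp at this
    nlinarith
  -- If f_xxy = 0, the Hessian is critical at 0, so its second derivative along the arc is f_xxxx
  -- f_yy. This must be 0, which makes both sides of the A₃ inequality 0.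
  have hxxy : px (px (py f)) 0 ≠ 0 := by
    intro hz
    have cX' : DifferentiableAt ℝ (deriv X) 0 :=
      (cX.derivWithin (m := ∞) (by simp)).differentiableAt (by simp)
    have cY' : DifferentiableAt ℝ (deriv Y) 0 :=
      (cY.derivWithin (m := ∞) (by simp)).differentiableAt (by simp)
    have e1 := ((HasDerivAt.comp_partials (contDiff_hess hf).px dX dY).mul cX'.hasDerivAt).add
      ((HasDerivAt.comp_partials (contDiff_hess hf).py dX dY).mul cY'.hasDerivAt)
    have e2 := e1.unique ((hasDerivAt_const (0 : ℝ) (0 : ℝ)).congr_of_eventuallyEq hder)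
    simp only [hX0, hY0, dX.deriv, dY.deriv, mul_one, mul_zero, add_zero, Prod.mk_zero_zero,
      px_px_hess hf, hpxh, hpyh, hxx, hxy, hz, hxxx, zero_mul] at e2
    rw [hz] at hne
    apply hne
    linarith
  exact ⟨f, V, hG, h0, hx, hy, hxx, hxy, hyy, hxxx, lt_of_le_of_ne hle hxxy, hne⟩

/-- A tangent vector along which the Hessian decreases is directed to the hyperbolic domain. -/
theorem IsGraphOn.isDirectedTo (hG : IsGraphOn S g b f V) {p : ℝ × ℝ}
    (hp : graphPt b g f p ∈ V) (hyy : py (py f) p ≠ 0) (hh : hess f p = 0) {a c : ℝ} (ha : a ≠ 0)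
    (hneg : px (hess f) p * a + py (hess f) p * c < 0) :
    IsDirectedTo S (hyperbolicDomain S) (graphPt b g f p) (graphVec b f p a c) := by
  have hf := hG.smooth
  have hline : Continuous fun t : ℝ => (p.1 + t * a, p.2 + t * c) := by fun_prop
  have hl0 : (p.1 + 0 * a, p.2 + 0 * c) = p := by simp
  have hV : ∀ᶠ t in 𝓝 (0 : ℝ), graphPt b g f (p.1 + t * a, p.2 + t * c) ∈ V :=
    ((ContDiff.graphPt hf).continuous.comp hline).continuousAt.eventually
      (by simpa using hG.isOpen.mem_nhds hp)
  have hyy' : ∀ᶠ t in 𝓝 (0 : ℝ), py (py f) (p.1 + t * a, p.2 + t * c) ≠ 0 :=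
    (hf.py.py.continuous.comp hline).continuousAt.eventually_ne (by simpa using hyy)
  have dh := hasDerivAt_line (contDiff_hess hf) p a c 0
  simp only [hl0] at dh
  have hsgn := dh.eventually_sign (by rw [hl0, hh]) hneg.ne
  obtain ⟨ε, hε, hball⟩ := Metric.eventually_nhds_iff_ball.1 ((hV.and hyy').and hsgn)
  rw [Real.ball_zero_eq_Ioo] at hball
  refine ⟨graphVec_ne_zero c ha, fun t => graphPt b g f (p.1 + t * a, p.2 + t * c), ε, hε, ?_,
    by simp, ?_, fun t ht => hG.graphPt_mem_iff (hball t ht).1.1, fun t ht => ?_⟩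
  · exact ((ContDiff.graphPt hf).comp
      (by fun_prop : ContDiff ℝ ∞ fun t : ℝ => (p.1 + t * a, p.2 + t * c))).contDiffOn
  · rw [(hasDerivAt_graphPt_line hf p a c 0).deriv]
    simp [graphVec]
  · obtain ⟨⟨h1, h2⟩, h3⟩ := hball t ⟨by linarith [ht.1], ht.2⟩
    exact (hG.hyperbolic_iff h1 h2).2 (h3.2.2 (mul_neg_of_neg_of_pos hneg ht.1))

/-- At the neighbouring parabolic points, the sign of the scalar product between a half-asymptotic
line directed to the hyperbolic domain and the secant to the godron is that of `godronSign`; and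
such half-lines exist. -/
theorem IsGodronJet.parabolic_index (hJ : IsGodronJet f) (hG : IsGraphOn S g b f V)
    (hx : IsArcTangent (parabolicCurve S) g (b 0)) :
    (𝓝[parabolicCurve S \ {g}] g).NeBot ∧ ∀ᶠ q in 𝓝[parabolicCurve S \ {g}] g,
      (∃ v, IsAsymptoticVector S q v ∧ IsDirectedTo S (hyperbolicDomain S) q v) ∧
      ∀ v, IsAsymptoticVector S q v → IsDirectedTo S (hyperbolicDomain S) q v →
        0 < godronSign f * inner ℝ v (g - q) := by
  have hf := hG.smooth
  have hyy0 := hJ.yy.ne'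
  have hD := hJ.godronSign_ne_zero
  obtain ⟨X, Y, cX, cY, hX0, hY0, dX, dY, hm, hev⟩ := hG.parabolic_arc hJ.zero hyy0 hx
  have hg0 : graphPt b g f 0 = g := graphPt_zero hJ.zero
  have hγ0 : graphPt b g f (X 0, Y 0) = g := by rw [hX0, hY0]; exact hg0
  have hXY : ContinuousAt (fun t => (X t, Y t)) 0 := dX.continuousAt.prodMk dY.continuousAt
  have e00 : (X 0, Y 0) = 0 := by rw [hX0, hY0]; rfl
  -- points of the arc distinct from `g`
  have hXs := dX.eventually_sign hX0 one_ne_zero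
  have hXne : ∀ᶠ t in 𝓝[≠] (0 : ℝ), graphPt b g f (X t, Y t) ≠ g := by
    filter_upwards [nhdsWithin_le_nhds hXs, self_mem_nhdsWithin] with t ht ht0 h
    have e := congrArg (fun q => crd b 0 (q - g)) h
    simp only [crd_zero_graphPt, sub_self, map_zero] at e
    rw [e] at ht
    simp only [lt_self_iff_false, one_mul, false_iff, not_lt] at ht
    exact ht0 (le_antisymm ht.1 ht.2)
  have htend : Tendsto (fun t => graphPt b g f (X t, Y t)) (𝓝[≠] 0)
      (𝓝[parabolicCurve S \ {g}] g) := by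
    have h1 : Tendsto (fun t => graphPt b g f (X t, Y t)) (𝓝[≠] 0) (𝓝[parabolicCurve S] g) :=
      (tendsto_iff_comap.2 (by rw [← hm]; exact le_comap_map)).mono_left nhdsWithin_le_nhds
    rw [tendsto_nhdsWithin_iff] at h1 ⊢
    exact ⟨h1.1, (h1.2.and hXne).mono fun t ht => ⟨ht.1, ht.2⟩⟩
  refine ⟨htend.neBot, ?_⟩
  -- the slope of the asymptotic direction and the derivative of the Hessian along it
  have hdiff : ∀ h : ℝ × ℝ → ℝ, ContDiff ℝ ∞ h →
      HasDerivAt (fun t => h (X t, Y t)) (px h 0) 0 := fun h hh => by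
    have := HasDerivAt.comp_partials hh dX dY
    rw [e00] at this
    simpa using this
  set r : ℝ → ℝ := fun t => -px (py f) (X t, Y t) / py (py f) (X t, Y t) with hr
  have hr0 : r 0 = 0 := by simp [r, e00, hJ.xy]
  have dr : HasDerivAt r (-px (px (py f)) 0 / py (py f) 0) 0 := by
    have := (hdiff _ hf.py.px).neg.div (hdiff _ hf.py.py) (by rw [e00]; exact hyy0)
    refine this.congr_deriv ?_
    simp only [Pi.neg_apply, e00, hJ.xy]
    field_simp
    ring
  -- `r` is the slope of the asymptotic direction and `s` the derivative of the Hessian along it. At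
  -- 0, s' = (f_xxxx f_yy - 2 f_xxy²) + f_xxy f_yy r' with r' = -f_xxy / f_yy, which is `godronSign
  -- f`.
  set s : ℝ → ℝ := fun t => px (hess f) (X t, Y t) + py (hess f) (X t, Y t) * r t with hs
  have hpxh : px (hess f) 0 = 0 := by
    simp [px_hess hf, hJ.xx, hJ.xy, hJ.xxx]
  have hpyh : py (hess f) 0 = px (px (py f)) 0 * py (py f) 0 := by
    simp [py_hess hf, hJ.xx, hJ.xy]
  have hs0 : s 0 = 0 := by simp only [s, hr0, e00, hpxh]; ring
  have ds : HasDerivAt s (godronSign f) 0 := by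
    have := (hdiff _ (contDiff_hess hf).px).add ((hdiff _ (contDiff_hess hf).py).mul dr)
    refine this.congr_deriv ?_
    simp only [e00, hr0, hpyh, px_px_hess hf, hJ.xx, hJ.xy, hJ.xxx, godronSign]
    field_simp
    ring
  have hss := ds.eventually_sign hs0 hD
  -- the scalar product of the asymptotic direction with the secant
  set ι : ℝ → ℝ := fun t => inner ℝ (graphVec b f (X t, Y t) 1 (r t))
    (graphPt b g f (X t, Y t) - g) with hι
  have hι0 : ι 0 = 0 := by simp [ι, hγ0]
  have dι : HasDerivAt ι (‖b 0‖ ^ 2) 0 := by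
    have d1 : HasDerivAt (fun t => graphPt b g f (X t, Y t) - g) (b 0) 0 := by
      have := (((dX.smul_const (b 0)).add (dY.smul_const (b 1))).add
        ((hdiff f hf).smul_const (b 2)))
      rw [hJ.x] at this
      have h2 : (fun t => graphPt b g f (X t, Y t) - g) =
          ((fun t => X t • b 0) + fun t => Y t • b 1) + fun t => f (X t, Y t) • b 2 := by
        ext1 t
        simp [graphPt]
      rw [h2]
      simpa using this
    have d2 : DifferentiableAt ℝ (fun t => graphVec b f (X t, Y t) 1 (r t)) 0 := by
      have a1 := (hdiff _ hf.px).differentiableAt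
      have a2 := (hdiff _ hf.py).differentiableAt
      have a3 := dr.differentiableAt
      unfold graphVec
      fun_prop
    have := d2.hasDerivAt.inner ℝ d1
    refine this.congr_deriv ?_
    rw [hγ0, e00, hr0]
    simp [graphVec, hJ.x]
  have hb0 : b 0 ≠ 0 := b.ne_zero 0
  have hιs := dι.eventually_sign hι0 (by positivity)
  have hyy' : ∀ᶠ t in 𝓝 (0 : ℝ), py (py f) (X t, Y t) ≠ 0 :=
    (hdiff _ hf.py.py).continuousAt.eventually_ne (by rw [e00]; exact hyy0)
  -- transfer to the arc
  have key : ∀ᶠ q in 𝓝[parabolicCurve S] g, q ≠ g →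
      (∃ v, IsAsymptoticVector S q v ∧ IsDirectedTo S (hyperbolicDomain S) q v) ∧
      ∀ v, IsAsymptoticVector S q v → IsDirectedTo S (hyperbolicDomain S) q v →
        0 < godronSign f * inner ℝ v (g - q) := by
    rw [← hm, eventually_map]
    filter_upwards [hev, hss, hιs, hyy'] with t ⟨hV, hh⟩ hst hιt hyt hne
    have ht0 : t ≠ 0 := by
      rintro rfl
      exact hne hγ0
    have hb0' : 0 < ‖b 0‖ ^ 2 := by positivity
    have hq : ∀ a : ℝ, quad f (X t, Y t) (a * 1) (a * r t) = 0 := fun a => by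
      have h1 := quad_mul_py_py f (X t, Y t) (a * 1) (a * r t)
      have h2 : py (py f) (X t, Y t) * (a * r t) + px (py f) (X t, Y t) * (a * 1) = 0 := by
        simp only [r]
        field_simp
        ring
      rw [h2, hh] at h1
      simpa [hyt] using h1
    have hs_ne : s t ≠ 0 := by
      intro hz
      rw [hz] at hst
      simp only [lt_self_iff_false, false_iff, not_lt] at hst
      exact mul_ne_zero hD ht0 (le_antisymm hst.1 hst.2)
    constructor
    -- Scaling the asymptotic vector by -s makes the derivative of the Hessian along it -s² < 0.
    · refine ⟨graphVec b f (X t, Y t) (-s t * 1) (-s t * r t),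
        (hG.isAsymptoticVector_graphVec hV _ _).2 (hq _),
        hG.isDirectedTo hV hyt hh (by simpa using hs_ne) ?_⟩
      have : 0 < s t ^ 2 := by positivity
      have h2 : s t = px (hess f) (X t, Y t) + py (hess f) (X t, Y t) * r t := rfl
      nlinarith
    · intro v hva hvd
      obtain ⟨h1, h2⟩ := (hG.isAsymptoticVector_iff hV v).1 hva
      have h3 := eq_smul_graphVec_of_hess_nonneg hyt hh.ge h1 h2
      have h4 := hG.hess_deriv_nonpos hV hyt hh hvd
      set a := crd b 0 v with ha
      have ha0 : a ≠ 0 := by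
        intro hz
        rw [hz, zero_smul] at h3
        exact hvd.1 h3
      have h5 : crd b 1 v = a * r t := by
        rw [h3]
        simp [r]
      -- A vector directed to the hyperbolic domain only gives a s ≤ 0; strictness comes from `s t ≠
      -- 0`. The signs of s and of the secant product ι are those of D t and t, so -a ι has the sign
      -- of D.
      have h6 : a * s t < 0 := by
        refine lt_of_le_of_ne ?_ (mul_ne_zero ha0 hs_ne)
        rw [h5] at h4
        have h2 : s t = px (hess f) (X t, Y t) + py (hess f) (X t, Y t) * r t := rfl
        rw [h2]
        linarith
      have h7 : inner ℝ v (g - graphPt b g f (X t, Y t)) = -(a * ι t) := by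
        rw [← neg_sub, inner_neg_right, h3, inner_smul_left]
        rfl
      rw [h7]
      rcases lt_or_gt_of_ne ha0 with hneg | hpos
      · have h8 : 0 < godronSign f * t := hst.1.1 (pos_of_mul_neg_right h6 hneg.le)
        rcases lt_or_gt_of_ne ht0 with htn | htp
        · have h9 : ι t < 0 := hιt.2.2 (mul_neg_of_pos_of_neg hb0' htn)
          have h10 : godronSign f < 0 := neg_of_mul_pos_left h8 htn.le
          nlinarith [mul_pos_of_neg_of_neg hneg h9]
        · have h9 : 0 < ι t := hιt.1.2 (mul_pos hb0' htp)
          have h10 : 0 < godronSign f := pos_of_mul_pos_left h8 htp.le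
          nlinarith [mul_neg_of_neg_of_pos hneg h9]
      · have h8 : godronSign f * t < 0 := hst.2.1 (neg_of_mul_neg_right h6 hpos.le)
        rcases lt_or_gt_of_ne ht0 with htn | htp
        · have h9 : ι t < 0 := hιt.2.2 (mul_neg_of_pos_of_neg hb0' htn)
          have h10 : 0 < godronSign f := pos_of_mul_neg_left h8 htn.le
          nlinarith [mul_neg_of_pos_of_neg hpos h9]
        · have h9 : 0 < ι t := hιt.1.2 (mul_pos hb0' htp)
          have h10 : godronSign f < 0 := neg_of_mul_neg_left h8 htp.le
          nlinarith [mul_pos hpos h9]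
  rw [sdiff_eq, nhdsWithin_inter', eventually_inf_principal]
  exact key

/-- The direct implication needs parabolic points other than `g` and actual half-lines at them, lest
the definition of the index hold vacuously; `IsGodronJet.parabolic_index` provides both. -/
theorem IsGodronJet.isPositiveGodron_iff (hJ : IsGodronJet f) (hG : IsGraphOn S g b f V)
    (hx : IsArcTangent (parabolicCurve S) g (b 0)) :
    IsPositiveGodron S g ↔ 0 < godronSign f := by
  obtain ⟨hne, hev⟩ := hJ.parabolic_index hG hx
  constructor
  · intro hp
    obtain ⟨q, ⟨⟨v, hva, hvd⟩, h1⟩, h2⟩ := (hev.and hp).exists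
    exact pos_of_mul_pos_left (h1 v hva hvd) (h2 v hva hvd).le
  · intro hpos
    filter_upwards [hev] with q hq v hva hvd
    exact pos_of_mul_pos_right (hq.2 v hva hvd) hpos.le

theorem IsGodronJet.isNegativeGodron_iff (hJ : IsGodronJet f) (hG : IsGraphOn S g b f V)
    (hx : IsArcTangent (parabolicCurve S) g (b 0)) :
    IsNegativeGodron S g ↔ godronSign f < 0 := by
  obtain ⟨hne, hev⟩ := hJ.parabolic_index hG hx
  constructor
  · intro hp
    obtain ⟨q, ⟨⟨v, hva, hvd⟩, h1⟩, h2⟩ := (hev.and hp).exists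
    exact neg_of_mul_pos_left (h1 v hva hvd) (h2 v hva hvd).le
  · intro hneg
    filter_upwards [hev] with q hq v hva hvd
    exact neg_of_mul_pos_right (hq.2 v hva hvd) hneg.le

end

/-! ### The flecnodal curve and its branches -/

section

variable {S : Set R3} {g : R3} {b : Module.Basis (Fin 3) ℝ R3} {f : ℝ × ℝ → ℝ} {V : Set R3}

/-- The x'-term disappears because f_xxx = 0, and the r'-term because f_xy = 0 and r = 0 at the
origin: this is what makes the Jacobian of the flecnodal equations triangular. -/
theorem IsGodronJet.hasDerivAt_quad (hJ : IsGodronJet f) (hf : ContDiff ℝ ∞ f) {X Y R : ℝ → ℝ}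
    {x' y' r' : ℝ} (hX0 : X 0 = 0) (hY0 : Y 0 = 0) (hR0 : R 0 = 0) (dX : HasDerivAt X x' 0)
    (dY : HasDerivAt Y y' 0) (dR : HasDerivAt R r' 0) :
    HasDerivAt (fun t => quad f (X t, Y t) 1 (R t)) (px (px (py f)) 0 * y') 0 := by
  have h1 := (HasDerivAt.comp_partials hf.px.px dX dY).mul_const ((1 : ℝ) ^ 2)
  have h2 := (((HasDerivAt.comp_partials hf.py.px dX dY).const_mul 2).mul_const (1 : ℝ)).mul dR
  have h3 := (HasDerivAt.comp_partials hf.py.py dX dY).mul (dR.pow 2)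
  refine ((h1.add h2).add h3).congr_deriv ?_
  simp [hX0, hY0, hR0, Prod.mk_zero_zero, hJ.xxx, hJ.xy, py_px hf.px, py_px hf]

theorem hasDerivAt_cubic (hf : ContDiff ℝ ∞ f) {X Y R : ℝ → ℝ} {x' y' r' : ℝ}
    (hX0 : X 0 = 0) (hY0 : Y 0 = 0) (hR0 : R 0 = 0) (dX : HasDerivAt X x' 0)
    (dY : HasDerivAt Y y' 0) (dR : HasDerivAt R r' 0) :
    HasDerivAt (fun t => cubic f (X t, Y t) 1 (R t)) (px (px (px (px f))) 0 * x' +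
      py (px (px (px f))) 0 * y' + 3 * px (px (py f)) 0 * r') 0 := by
  have h1 := (HasDerivAt.comp_partials hf.px.px.px dX dY).mul_const ((1 : ℝ) ^ 3)
  have h2 := (((HasDerivAt.comp_partials hf.py.px.px dX dY).const_mul 3).mul_const
    ((1 : ℝ) ^ 2)).mul dR
  have h3 := (((HasDerivAt.comp_partials hf.py.py.px dX dY).const_mul 3).mul_const (1 : ℝ)).mul
    (dR.pow 2)
  have h4 := (HasDerivAt.comp_partials hf.py.py.py dX dY).mul (dR.pow 3)
  refine (((h1.add h2).add h3).add h4).congr_deriv ?_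
  simp [hX0, hY0, hR0, Prod.mk_zero_zero]

/-- Near a godron, the flecnodal curve and the corresponding asymptotic directions are functions
of `x`; the twist along them has a simple zero at the godron. -/
theorem IsGodronJet.exists_branch (hJ : IsGodronJet f) (hf : ContDiff ℝ ∞ f) :
    ∃ (ψ : ℝ → ℝ × ℝ) (W : Set ℝ), IsOpen W ∧ (0 : ℝ) ∈ W ∧ ContDiffOn ℝ ∞ ψ W ∧ ψ 0 = 0 ∧
      (∀ᶠ v in 𝓝 (0 : ℝ × (ℝ × ℝ)), (quad f (v.1, v.2.1) 1 v.2.2 = 0 ∧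
        cubic f (v.1, v.2.1) 1 v.2.2 = 0) ↔ ψ v.1 = v.2) ∧
      HasDerivAt (fun t => px (py f) (t, (ψ t).1) + py (py f) (t, (ψ t).1) * (ψ t).2)
        (godronSign f / (-3 * px (px (py f)) 0)) 0 := by
  let G : ℝ × (ℝ × ℝ) → ℝ × ℝ := fun v =>
    (quad f (v.1, v.2.1) 1 v.2.2, cubic f (v.1, v.2.1) 1 v.2.2)
  have hGs : ContDiff ℝ ∞ G := by
    have h1 := hf.px
    have h2 := hf.py
    unfold G quad cubic
    fun_prop
  have hG0 : G 0 = 0 := by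
    simp [G, quad, cubic, Prod.mk_zero_zero, hJ.xx, hJ.xxx]
  have dG : HasFDerivAt G (fderiv ℝ G 0) 0 := (hGs.differentiable (by simp) 0).hasFDerivAt
  have hm := hJ.xxy.ne
  have hGder : ∀ a c : ℝ, fderiv ℝ G 0 (0, (a, c)) = (px (px (py f)) 0 * a,
      py (px (px (px f))) 0 * a + 3 * px (px (py f)) 0 * c) := by
    intro a c
    have dX := hasDerivAt_const (0 : ℝ) (0 : ℝ)
    have dY : HasDerivAt (fun t : ℝ => t * a) a 0 := by
      simpa using (hasDerivAt_id (0 : ℝ)).mul_const a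
    have dR : HasDerivAt (fun t : ℝ => t * c) c 0 := by
      simpa using (hasDerivAt_id (0 : ℝ)).mul_const c
    have h1 := (hJ.hasDerivAt_quad hf rfl (by simp) (by simp) dX dY dR).prodMk
      (hasDerivAt_cubic hf rfl (by simp) (by simp) dX dY dR)
    have dl : HasDerivAt (fun t : ℝ => ((0 : ℝ), (t * a, t * c))) (0, (a, c)) 0 :=
      dX.prodMk (dY.prodMk dR)
    have dG' : HasFDerivAt G (fderiv ℝ G 0) ((fun t : ℝ => ((0 : ℝ), (t * a, t * c))) 0) := by
      simpa [Prod.mk_zero_zero] using dG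
    have h2 := dG'.comp_hasDerivAt (0 : ℝ) dl
    rw [h2.unique h1]
    simp
  have hinv : (fderiv ℝ G 0 ∘L .inr ℝ ℝ (ℝ × ℝ)).IsInvertible := by
    have hinj : Function.Injective ((fderiv ℝ G 0 ∘L .inr ℝ ℝ (ℝ × ℝ) : (ℝ × ℝ) →L[ℝ] (ℝ × ℝ)) :
        (ℝ × ℝ) →ₗ[ℝ] (ℝ × ℝ)) := by
      rw [injective_iff_map_eq_zero]
      rintro ⟨a, c⟩ h
      have h' : fderiv ℝ G 0 (0, (a, c)) = 0 := h
      rw [hGder, Prod.mk_eq_zero] at h'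
      have ha : a = 0 := (mul_eq_zero.1 h'.1).resolve_left hm
      have h2 := h'.2
      rw [ha, mul_zero, zero_add] at h2
      have hc : c = 0 := (mul_eq_zero.1 h2).resolve_left (mul_ne_zero three_ne_zero hm)
      rw [ha, hc]
      rfl
    refine ⟨(LinearEquiv.ofInjectiveEndo _ hinj).toContinuousLinearEquiv, ?_⟩
    ext <;> rfl
  obtain ⟨ψ, W, hW, h0W, hψ, hψ0, hiff⟩ := exists_contDiffOn_implicitFunction isOpen_univ
    (mem_univ (0 : ℝ × (ℝ × ℝ))) hGs.contDiffOn hinv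
  have hψ0' : ψ 0 = 0 := hψ0
  refine ⟨ψ, W, hW, h0W, hψ, hψ0, ?_, ?_⟩
  · filter_upwards [hiff] with v hv
    rw [← hv, hG0]
    exact Prod.mk_eq_zero.symm
  · have dψ : DifferentiableAt ℝ ψ 0 :=
      (hψ.contDiffAt (hW.mem_nhds h0W)).differentiableAt (by simp)
    have dY : HasDerivAt (fun t => (ψ t).1) (deriv ψ 0).1 0 :=
      (ContinuousLinearMap.fst ℝ ℝ ℝ).hasFDerivAt.comp_hasDerivAt (0 : ℝ) dψ.hasDerivAt
    have dR : HasDerivAt (fun t => (ψ t).2) (deriv ψ 0).2 0 :=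
      (ContinuousLinearMap.snd ℝ ℝ ℝ).hasFDerivAt.comp_hasDerivAt (0 : ℝ) dψ.hasDerivAt
    have hgr : Tendsto (fun t => (t, ψ t)) (𝓝 0) (𝓝 (0 : ℝ × (ℝ × ℝ))) := by
      have := continuousAt_id.prodMk dψ.continuousAt
      have := this.tendsto
      simpa [hψ0', Prod.mk_zero_zero] using this
    have hev : ∀ᶠ t in 𝓝 (0 : ℝ), G (t, ψ t) = 0 := by
      filter_upwards [hgr.eventually hiff] with t ht
      rw [← hG0]
      exact ht.2 rfl
    have hY0 : (fun t => (ψ t).1) 0 = 0 := by simp [hψ0']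
    have hR0 : (fun t => (ψ t).2) 0 = 0 := by simp [hψ0']
    have q1 := hJ.hasDerivAt_quad hf rfl hY0 hR0 (hasDerivAt_id (0 : ℝ)) dY dR
    have q2 := hasDerivAt_cubic hf rfl hY0 hR0 (hasDerivAt_id (0 : ℝ)) dY dR
    have z1 := q1.unique ((hasDerivAt_const (0 : ℝ) (0 : ℝ)).congr_of_eventuallyEq
      (hev.mono fun t ht => congrArg Prod.fst ht))
    have z2 := q2.unique ((hasDerivAt_const (0 : ℝ) (0 : ℝ)).congr_of_eventuallyEq
      (hev.mono fun t ht => congrArg Prod.snd ht))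
    -- The first equation gives y' = 0, so the flecnodal curve is tangent to the x-axis; the second
    -- then reads f_xxxx + 3 f_xxy r' = 0.
    have z3 : (deriv ψ 0).1 = 0 := (mul_eq_zero.1 z1).resolve_left hm
    rw [z3] at z2
    have e1 := (HasDerivAt.comp_partials hf.py.px (hasDerivAt_id (0 : ℝ)) dY).add
      ((HasDerivAt.comp_partials hf.py.py (hasDerivAt_id (0 : ℝ)) dY).mul dR)
    refine e1.congr_deriv ?_
    simp only [id, hψ0', Prod.fst_zero, Prod.snd_zero, Prod.mk_zero_zero, z3, mul_zero, add_zero,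
      mul_one, zero_add]
    rw [godronSign]
    field_simp
    linear_combination py (py f) 0 * z2

/-- Near a point where the second differential of `f` is a positive multiple of `dy ^ 2`, the
slopes of the asymptotic directions are small. -/
theorem IsGodronJet.eventually_slope_lt (hJ : IsGodronJet f) (hf : ContDiff ℝ ∞ f) {ρ : ℝ}
    (hρ : 0 < ρ) : ∀ᶠ p in 𝓝 (0 : ℝ × ℝ), ∀ r, quad f p 1 r = 0 → |r| < ρ := by
  have hc : Continuous fun p => py (py f) p * ρ ^ 2 - |px (px f) p| - 2 * |px (py f) p| * ρ := by
    have h1 := hf.px.px.continuous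
    have h2 := hf.py.px.continuous
    have h3 := hf.py.py.continuous
    fun_prop
  have h0 : (0 : ℝ) < py (py f) 0 * ρ ^ 2 - |px (px f) 0| - 2 * |px (py f) 0| * ρ := by
    have := hJ.yy
    rw [hJ.xx, hJ.xy]
    simp
    positivity
  filter_upwards [continuousAt_const.eventually_lt hc.continuousAt h0] with p hp r hr
  by_contra! hle
  rw [quad] at hr
  have h1 : -|px (px f) p| ≤ px (px f) p := neg_abs_le _
  have h2 : -(|px (py f) p| * |r|) ≤ px (py f) p * r := by
    rw [← abs_mul]
    exact neg_abs_le _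
  have h3 : r ^ 2 = |r| ^ 2 := (sq_abs r).symm
  have h4 : 0 ≤ |px (px f) p| := abs_nonneg _
  have h5 : 0 ≤ |px (py f) p| := abs_nonneg _
  have h6 : py (py f) p * |r| ^ 2 - |px (px f) p| - 2 * |px (py f) p| * |r| ≤ 0 := by
    rw [← h3]
    linarith
  -- Writing |r| = s ρ with s ≥ 1, the vanishing of the quadratic form forces s² times the positive
  -- quantity of `hp` to be at most 0.
  set s := |r| / ρ with hs
  have h7 : |r| = s * ρ := by rw [hs]; field_simp
  have h8 : 1 ≤ s := (one_le_div hρ).2 hle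
  rw [h7] at h6
  have h9 : s ^ 2 * (py (py f) p * ρ ^ 2 - |px (px f) p| - 2 * |px (py f) p| * ρ) ≤ 0 := by
    have a1 : |px (px f) p| ≤ s ^ 2 * |px (px f) p| :=
      le_mul_of_one_le_left h4 (one_le_pow₀ h8)
    have a2 : s * (|px (py f) p| * ρ) ≤ s ^ 2 * (|px (py f) p| * ρ) := by
      refine mul_le_mul_of_nonneg_right ?_ (by positivity)
      nlinarith
    linarith
  have h10 : 0 < s ^ 2 * (py (py f) p * ρ ^ 2 - |px (px f) p| - 2 * |px (py f) p| * ρ) :=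
    mul_pos (by positivity) hp
  linarith

theorem quad_eq_sq_mul (f : ℝ × ℝ → ℝ) (p : ℝ × ℝ) {a : ℝ} (c : ℝ) (ha : a ≠ 0) :
    quad f p a c = a ^ 2 * quad f p 1 (c / a) := by
  rw [quad, quad]
  field_simp

theorem cubic_eq_cube_mul (f : ℝ × ℝ → ℝ) (p : ℝ × ℝ) {a : ℝ} (c : ℝ) (ha : a ≠ 0) :
    cubic f p a c = a ^ 3 * cubic f p 1 (c / a) := by
  rw [cubic, cubic]
  field_simp

/-- The lines with 4-point contact, in coordinates. -/
theorem IsGraphOn.lineContact_four_iff_exists (hG : IsGraphOn S g b f V) {p : ℝ × ℝ}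
    (hp : graphPt b g f p ∈ V) (hyy : py (py f) p ≠ 0) (v : R3) :
    (v ≠ 0 ∧ LineContact S (graphPt b g f p) v 4) ↔
      ∃ a r : ℝ, a ≠ 0 ∧ v = graphVec b f p a (a * r) ∧ quad f p 1 r = 0 ∧ cubic f p 1 r = 0 := by
  rw [hG.lineContact_four_iff hp]
  constructor
  · rintro ⟨hv, h1, h2, h3⟩
    have ha : crd b 0 v ≠ 0 := by
      intro ha
      rw [ha, quad] at h2
      have hc : crd b 1 v = 0 := by simpa [hyy] using h2
      refine hv (ext_crd (b := b) ?_ ?_ ?_) <;> simp [ha, hc, h1]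
    refine ⟨crd b 0 v, crd b 1 v / crd b 0 v, ha, ?_, ?_, ?_⟩
    · rw [mul_div_cancel₀ _ ha]
      exact eq_graphVec h1
    · rw [quad_eq_sq_mul f p _ ha] at h2
      exact (mul_eq_zero.1 h2).resolve_left (pow_ne_zero 2 ha)
    · rw [cubic_eq_cube_mul f p _ ha] at h3
      exact (mul_eq_zero.1 h3).resolve_left (pow_ne_zero 3 ha)
  · rintro ⟨a, r, ha, rfl, h2, h3⟩
    refine ⟨graphVec_ne_zero _ ha, by simp, ?_, ?_⟩
    · rw [crd_zero_graphVec, crd_one_graphVec, quad_eq_sq_mul f p _ ha, mul_div_cancel_left₀ _ ha,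
        h2, mul_zero]
    · rw [crd_zero_graphVec, crd_one_graphVec, cubic_eq_cube_mul f p _ ha,
        mul_div_cancel_left₀ _ ha, h3, mul_zero]

/-- The flecnodal curve and its branches near a simple godron. -/
theorem IsGodronJet.flecnodal (hJ : IsGodronJet f) (hG : IsGraphOn S g b f V) :
    ∃ (ε : ℝ) (U : Set R3) (c : ℝ → R3), 0 < ε ∧ U ∈ 𝓝 g ∧
      ContDiffOn ℝ ∞ c (Ioo (-ε) ε) ∧ c 0 = g ∧
      (∀ t ∈ Ioo (-ε) ε, crd b 0 (c t - g) = t) ∧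
      flecnodalCurve S ∩ U = c '' Ioo (-ε) ε ∧
      leftFlecnodalCurve b.orientation S ∩ U = c '' {t ∈ Ioo (-ε) ε | godronSign f * t < 0} ∧
      rightFlecnodalCurve b.orientation S ∩ U = c '' {t ∈ Ioo (-ε) ε | 0 < godronSign f * t} := by
  have hf := hG.smooth
  obtain ⟨ψ, W, hW, h0W, hψ, hψ0, hiff, dQ⟩ := hJ.exists_branch hf
  set Q : ℝ → ℝ := fun t => px (py f) (t, (ψ t).1) + py (py f) (t, (ψ t).1) * (ψ t).2 with hQ
  have hg0 : graphPt b g f 0 = g := graphPt_zero hJ.zero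
  have hm : 0 < -3 * px (px (py f)) 0 := by linarith [hJ.xxy]
  have hQ0 : Q 0 = 0 := by simp [Q, hψ0, Prod.mk_zero_zero, hJ.xy]
  have hQs : ∀ᶠ t in 𝓝 (0 : ℝ), (0 < Q t ↔ 0 < godronSign f * t) ∧
      (Q t < 0 ↔ godronSign f * t < 0) := by
    filter_upwards [dQ.eventually_sign hQ0 (div_ne_zero hJ.godronSign_ne_zero hm.ne')] with t ht
    rw [ht.1, ht.2, div_mul_eq_mul_div, div_pos_iff_of_pos_right hm, div_neg_iff]
    refine ⟨Iff.rfl, fun h => ?_, fun h => Or.inr ⟨h, hm⟩⟩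
    exact h.elim (fun h => absurd hm h.2.not_gt) fun h => h.1
  -- conditions on the point of the plane
  have hcψ : ContinuousAt ψ 0 := (hψ.contDiffAt (hW.mem_nhds h0W)).continuousAt
  obtain ⟨ρ, hρ, hρiff⟩ := Metric.eventually_nhds_iff_ball.1 hiff
  -- The implicit function theorem only controls small r. The slope bound removes this restriction:
  -- every asymptotic slope over a point near 0 lies in the ball where uniqueness holds.
  have huniq : ∀ᶠ p in 𝓝 (0 : ℝ × ℝ), ∀ r, quad f p 1 r = 0 → cubic f p 1 r = 0 →
      ψ p.1 = (p.2, r) := by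
    filter_upwards [hJ.eventually_slope_lt hf hρ, Metric.ball_mem_nhds (0 : ℝ × ℝ) hρ]
      with p h1 h2 r h3 h4
    refine (hρiff (p.1, (p.2, r)) ?_).1 ⟨h3, h4⟩
    have h5 := h1 r h3
    rw [mem_ball_zero_iff, Prod.norm_def, max_lt_iff] at h2 ⊢
    refine ⟨h2.1, ?_⟩
    rw [Prod.norm_def, max_lt_iff]
    exact ⟨h2.2, h5⟩
  have hN : ∀ᶠ p in 𝓝 (0 : ℝ × ℝ), (graphPt b g f p ∈ V ∧ py (py f) p ≠ 0) ∧
      ∀ r, quad f p 1 r = 0 → cubic f p 1 r = 0 → ψ p.1 = (p.2, r) := by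
    refine (Eventually.and ?_ ?_).and huniq
    · exact (ContDiff.graphPt hf).continuous.continuousAt.eventually
        (by rw [hg0]; exact hG.isOpen.mem_nhds hG.mem)
    · exact hf.py.py.continuous.continuousAt.eventually_ne hJ.yy.ne'
  have hcurve : Tendsto (fun t => (t, (ψ t).1)) (𝓝 0) (𝓝 (0 : ℝ × ℝ)) := by
    have h1 : ContinuousAt (fun t => (t, (ψ t).1)) 0 := continuousAt_id.prodMk hcψ.fst
    have := h1.tendsto
    simpa [hψ0, Prod.mk_zero_zero] using this
  have hcurve' : Tendsto (fun t => (t, ψ t)) (𝓝 0) (𝓝 (0 : ℝ × (ℝ × ℝ))) := by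
    have := (continuousAt_id.prodMk hcψ).tendsto
    simpa [hψ0, Prod.mk_zero_zero] using this
  obtain ⟨ε, hε, hball⟩ := Metric.eventually_nhds_iff_ball.1
    (((hcurve.eventually hN).and (hcurve'.eventually hiff)).and (hQs.and (hW.mem_nhds h0W)))
  rw [Real.ball_zero_eq_Ioo] at hball
  set c : ℝ → R3 := fun t => graphPt b g f (t, (ψ t).1) with hc
  set U : Set R3 := {q | q ∈ V ∧ crd b 0 (q - g) ∈ Ioo (-ε) ε ∧
    ((graphPt b g f (crd b 0 (q - g), crd b 1 (q - g)) ∈ V ∧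
      py (py f) (crd b 0 (q - g), crd b 1 (q - g)) ≠ 0) ∧
      ∀ r, quad f (crd b 0 (q - g), crd b 1 (q - g)) 1 r = 0 →
        cubic f (crd b 0 (q - g), crd b 1 (q - g)) 1 r = 0 →
        ψ (crd b 0 (q - g)) = (crd b 1 (q - g), r))} with hU
  have hUg : U ∈ 𝓝 g := by
    have h1 : Tendsto (fun q => (crd b 0 (q - g), crd b 1 (q - g))) (𝓝 g) (𝓝 (0 : ℝ × ℝ)) := by
      have : Continuous fun q => (crd b 0 (q - g), crd b 1 (q - g)) := by fun_prop
      simpa [Prod.mk_zero_zero] using this.tendsto g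
    have h2 : Tendsto (fun q => crd b 0 (q - g)) (𝓝 g) (𝓝 0) := by
      have : Continuous fun q => crd b 0 (q - g) := by fun_prop
      simpa using this.tendsto g
    filter_upwards [hG.isOpen.mem_nhds hG.mem,
      h2.eventually (Ioo_mem_nhds (by linarith : -ε < 0) hε), h1.eventually hN] with q a1 a2 a3
    exact ⟨a1, a2, a3⟩
  have hcoord : ∀ t, crd b 0 (c t - g) = t := fun t => by simp [c]
  have hcU : ∀ t ∈ Ioo (-ε) ε, c t ∈ U := by
    intro t ht
    obtain ⟨⟨h1, -⟩, -⟩ := hball t ht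
    simp only [hU, mem_ofPred_eq, c, crd_zero_graphPt, crd_one_graphPt]
    exact ⟨h1.1.1, ht, h1⟩
  -- the asymptotic direction with 4-point contact at `c t`
  have hzero : ∀ t ∈ Ioo (-ε) ε, quad f (t, (ψ t).1) 1 (ψ t).2 = 0 ∧
      cubic f (t, (ψ t).1) 1 (ψ t).2 = 0 := fun t ht => (hball t ht).1.2.2 rfl
  -- On an asymptotic direction (1, r) the completed square reads Q² = -H.
  have hhyp : ∀ t ∈ Ioo (-ε) ε, Q t ≠ 0 → c t ∈ hyperbolicDomain S := by
    intro t ht hQt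
    obtain ⟨⟨⟨⟨h1, h2⟩, -⟩, -⟩, -⟩ := hball t ht
    rw [hG.hyperbolic_iff h1 h2]
    have h3 := quad_mul_py_py f (t, (ψ t).1) 1 (ψ t).2
    rw [(hzero t ht).1] at h3
    have h4 : 0 < Q t ^ 2 := by positivity
    simp only [Q] at h4
    linarith
  have hcsm : ContDiffOn ℝ ∞ c (Ioo (-ε) ε) := by
    have h1 : ContDiffOn ℝ ∞ ψ (Ioo (-ε) ε) := hψ.mono fun t ht => (hball t ht).2.2
    exact (ContDiff.graphPt hf).comp_contDiffOn (contDiffOn_id.prodMk h1.fst)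
  have hc0 : c 0 = g := by simp only [c, hψ0]; exact hg0
  have h0I : (0 : ℝ) ∈ Ioo (-ε) ε := ⟨by linarith, hε⟩
  have hQne : ∀ t ∈ Ioo (-ε) ε, t ≠ 0 → Q t ≠ 0 := by
    intro t ht ht0 hQt
    have := (hball t ht).2.1
    rw [hQt] at this
    simp only [lt_self_iff_false, false_iff, not_lt] at this
    exact mul_ne_zero hJ.godronSign_ne_zero ht0 (le_antisymm this.1 this.2)
  -- The godron itself is parabolic; it lies in the closure as a limit of the hyperbolic points of
  -- the curve.
  have hclos : ∀ t ∈ Ioo (-ε) ε, c t ∈ closure (hyperbolicDomain S) := by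
    intro t ht
    by_cases ht0 : t = 0
    · subst ht0
      have h1 : Tendsto c (𝓝[≠] 0) (𝓝 (c 0)) :=
        ((hcsm.continuousOn.continuousAt (Ioo_mem_nhds h0I.1 h0I.2)).tendsto).mono_left
          nhdsWithin_le_nhds
      refine mem_closure_of_tendsto h1 ?_
      filter_upwards [self_mem_nhdsWithin, nhdsWithin_le_nhds (Ioo_mem_nhds h0I.1 h0I.2)]
        with s hs0 hs
      exact hhyp s hs (hQne s hs hs0)
    · exact subset_closure (hhyp t ht (hQne t ht ht0))
  -- any flecnodal point of `U` is on the curve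
  have honc : ∀ q ∈ flecnodalCurve S ∩ U, ∃ t ∈ Ioo (-ε) ε, c t = q := by
    rintro q ⟨⟨hqS, -, v, hv, hv4⟩, hqV, hqI, ⟨hqV', hqy⟩, hqu⟩
    have e := eq_graphPt ((hG.mem_iff q hqV).1 hqS)
    rw [e] at hv4
    obtain ⟨a, r, -, -, h1, h2⟩ := (hG.lineContact_four_iff_exists hqV' hqy v).1 ⟨hv, hv4⟩
    refine ⟨_, hqI, ?_⟩
    simp only [c]
    rw [hqu r h1 h2]
    exact e.symm
  have hcflec : ∀ t ∈ Ioo (-ε) ε, c t ∈ flecnodalCurve S := by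
    intro t ht
    obtain ⟨⟨⟨⟨h1, h2⟩, -⟩, -⟩, -⟩ := hball t ht
    obtain ⟨h3, h4⟩ := (hG.lineContact_four_iff_exists h1 h2 _).2
      ⟨1, (ψ t).2, one_ne_zero, rfl, hzero t ht⟩
    exact ⟨hG.graphPt_mem_iff h1, hclos t ht, _, h3, h4⟩
  have hvec : ∀ t ∈ Ioo (-ε) ε, ∀ v, v ≠ 0 ∧ LineContact S (c t) v 4 ↔
      ∃ a, a ≠ 0 ∧ v = graphVec b f (t, (ψ t).1) a (a * (ψ t).2) := by
    intro t ht v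
    obtain ⟨⟨⟨⟨h1, h2⟩, h5⟩, -⟩, -⟩ := hball t ht
    rw [hG.lineContact_four_iff_exists h1 h2]
    constructor
    · rintro ⟨a, r, ha, rfl, h3, h4⟩
      refine ⟨a, ha, ?_⟩
      have := h5 r h3 h4
      rw [show r = (ψ t).2 by rw [this]]
    · rintro ⟨a, ha, rfl⟩
      exact ⟨a, _, ha, rfl, hzero t ht⟩
  have hquad : ∀ t ∈ Ioo (-ε) ε, ∀ a : ℝ, quad f (t, (ψ t).1) a (a * (ψ t).2) = 0 := by
    intro t ht a
    have : quad f (t, (ψ t).1) a (a * (ψ t).2) = a ^ 2 * quad f (t, (ψ t).1) 1 (ψ t).2 := by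
      rw [quad, quad]
      ring
    rw [this, (hzero t ht).1, mul_zero]
  -- The twist changes by the square a² when the vector is rescaled, so every vector of the 4-point
  -- contact line gives the same side.
  have htw : ∀ t a : ℝ, a * (px (py f) (t, (ψ t).1) * a + py (py f) (t, (ψ t).1) *
      (a * (ψ t).2)) = a ^ 2 * Q t := fun t a => by
    simp only [Q]
    ring
  refine ⟨ε, U, c, hε, hUg, hcsm, hc0, fun t _ => hcoord t, ?_, ?_, ?_⟩
  · ext q
    refine ⟨honc q, ?_⟩
    rintro ⟨t, ht, rfl⟩
    exact ⟨hcflec t ht, hcU t ht⟩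
  · ext q
    constructor
    · rintro ⟨⟨hq, v, hv, hv4, hvl⟩, hqU⟩
      obtain ⟨t, ht, rfl⟩ := honc q ⟨hq, hqU⟩
      obtain ⟨a, ha, rfl⟩ := (hvec t ht v).1 ⟨hv, hv4⟩
      rw [hc, hG.leftAsymptotic_iff (hball t ht).1.1.1.1 hvl.1 ha (hquad t ht a), htw] at hvl
      exact ⟨t, ⟨ht, (hball t ht).2.1.2.1 (neg_of_mul_neg_right hvl (sq_nonneg a))⟩, rfl⟩
    · rintro ⟨t, ⟨ht, hneg⟩, rfl⟩
      have hQt := (hball t ht).2.1.2.2 hneg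
      obtain ⟨h1, h2⟩ := (hvec t ht _).2 ⟨1, one_ne_zero, rfl⟩
      refine ⟨⟨hcflec t ht, _, h1, h2, ?_⟩, hcU t ht⟩
      rw [hc, hG.leftAsymptotic_iff (hball t ht).1.1.1.1 (hhyp t ht hQt.ne) one_ne_zero
        (hquad t ht 1), htw]
      simpa using hQt
  · ext q
    constructor
    · rintro ⟨⟨hq, v, hv, hv4, hvl⟩, hqU⟩
      obtain ⟨t, ht, rfl⟩ := honc q ⟨hq, hqU⟩
      obtain ⟨a, ha, rfl⟩ := (hvec t ht v).1 ⟨hv, hv4⟩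
      rw [hc, hG.rightAsymptotic_iff (hball t ht).1.1.1.1 hvl.1 ha (hquad t ht a), htw] at hvl
      exact ⟨t, ⟨ht, (hball t ht).2.1.1.1 (pos_of_mul_pos_right hvl (sq_nonneg a))⟩, rfl⟩
    · rintro ⟨t, ⟨ht, hpos⟩, rfl⟩
      have hQt := (hball t ht).2.1.1.2 hpos
      obtain ⟨h1, h2⟩ := (hvec t ht _).2 ⟨1, one_ne_zero, rfl⟩
      refine ⟨⟨hcflec t ht, _, h1, h2, ?_⟩, hcU t ht⟩
      rw [hc, hG.rightAsymptotic_iff (hball t ht).1.1.1.1 (hhyp t ht hQt.ne') one_ne_zero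
        (hquad t ht 1), htw]
      simpa using hQt

end

/-! ### Conclusion -/

theorem theorem8 (o : Orientation ℝ R3 (Fin 3)) (S : Set R3) (hS : IsSmoothSurface S)
    (g : R3) (hg : IsSimpleGodron S g)
    (b : Module.Basis (Fin 3) ℝ R3) (hb : IsAdaptedFrame o S g b) :
    ∃ (ε : ℝ) (U : Set R3) (c : ℝ → R3), 0 < ε ∧ U ∈ 𝓝 g ∧
      ContDiffOn ℝ ∞ c (Ioo (-ε) ε) ∧ c 0 = g ∧
      (∀ t ∈ Ioo (-ε) ε, b.coord 0 (c t - g) = t) ∧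
      flecnodalCurve S ∩ U = c '' Ioo (-ε) ε ∧
      ((leftFlecnodalCurve o S ∩ U = c '' Ioo (-ε) 0 ∧
          rightFlecnodalCurve o S ∩ U = c '' Ioo 0 ε) ↔ IsPositiveGodron S g) ∧
      ((leftFlecnodalCurve o S ∩ U = c '' Ioo 0 ε ∧
          rightFlecnodalCurve o S ∩ U = c '' Ioo (-ε) 0) ↔ IsNegativeGodron S g) := by
  obtain ⟨f, V, hG, hJ⟩ := exists_isGodronJet hS hg hb
  obtain ⟨ε, U, c, hε, hU, hc, hc0, hcoord, hF, hL, hR⟩ := hJ.flecnodal hG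
  rw [hb.positive] at hL hR
  refine ⟨ε, U, c, hε, hU, hc, hc0, hcoord, hF, ?_⟩
  rw [hJ.isPositiveGodron_iff hG hb.x_parabolic, hJ.isNegativeGodron_iff hG hb.x_parabolic, hL, hR]
  -- The two half-branches are distinct sets because x recovers the parameter. So the configuration
  -- of one sign excludes that of the other, which yields the implications from the position of the
  -- branches to the index.
  have hne : c '' Ioo 0 ε ≠ c '' Ioo (-ε) 0 := by
    intro h
    have h1 : c (ε / 2) ∈ c '' Ioo 0 ε := ⟨ε / 2, ⟨by linarith, by linarith⟩, rfl⟩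
    rw [h] at h1
    obtain ⟨t, ht, hte⟩ := h1
    have h2 := hcoord t ⟨ht.1, by linarith [ht.2]⟩
    have h3 := hcoord (ε / 2) ⟨by linarith, by linarith⟩
    rw [hte, h3] at h2
    linarith [ht.2]
  rcases lt_or_gt_of_ne hJ.godronSign_ne_zero with hD | hD
  · have e1 : {t ∈ Ioo (-ε) ε | godronSign f * t < 0} = Ioo 0 ε := by
      ext t
      refine ⟨fun h => ⟨pos_of_mul_neg_right h.2 hD.le, h.1.2⟩,
        fun h => ⟨⟨by linarith [h.1], h.2⟩, mul_neg_of_neg_of_pos hD h.1⟩⟩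
    have e2 : {t ∈ Ioo (-ε) ε | 0 < godronSign f * t} = Ioo (-ε) 0 := by
      ext t
      refine ⟨fun h => ⟨h.1.1, neg_of_mul_pos_right h.2 hD.le⟩,
        fun h => ⟨⟨h.1, by linarith [h.2]⟩, mul_pos_of_neg_of_neg hD h.2⟩⟩
    rw [e1, e2]
    exact ⟨⟨fun h => absurd h.1 hne, fun h => absurd h hD.not_gt⟩, by simp [hD]⟩
  · have e1 : {t ∈ Ioo (-ε) ε | godronSign f * t < 0} = Ioo (-ε) 0 := by
      ext t
      refine ⟨fun h => ⟨h.1.1, neg_of_mul_neg_right h.2 hD.le⟩,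
        fun h => ⟨⟨h.1, by linarith [h.2]⟩, mul_neg_of_pos_of_neg hD h.2⟩⟩
    have e2 : {t ∈ Ioo (-ε) ε | 0 < godronSign f * t} = Ioo 0 ε := by
      ext t
      refine ⟨fun h => ⟨pos_of_mul_pos_right h.2 hD.le, h.1.2⟩,
        fun h => ⟨⟨by linarith [h.1], h.2⟩, mul_pos hD h.1⟩⟩
    rw [e1, e2]
    exact ⟨by simp [hD], fun h => absurd h.1 hne.symm, fun h => absurd h hD.not_gt⟩
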